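/- **Theorem (Asymptotic normality of multivariate NLS estimators).** Let $(Y_i,X_i)_{i\ge 1}$ be i.i.d., $Y_i\in\mathbb R^m$, $X_i$ in a measurable space $\mathcal X$, with $$Y_i=g(X_i,\beta_0)+\varepsilon_i,\qquad E[\varepsilon_i\mid X_i]=0,\qquad \Omega_i:=\mathrm{Var}(\varepsilon_i\mid X_i),$$ where $\Theta\subset\mathbb R^p$, $\beta_0\in\Theta$, and $g:\mathcal X\times\Theta\to\mathbb R^m$ is measurable in $x$ and continuous in $\beta\in\Theta$. Write $G_i(\beta)=\partial g(X_i,\beta)/\partial\beta'$ (an $m\times p$ matrix) and $S_n(\beta)=\sum_{i=1}^n\|Y_i-g(X_i,\beta)\|^2$. Let $\hat\beta=\hat\beta_n$ be random vectors such that, with probability tending to one, $\hat\beta_n\in\Theta$ and $\hat\beta_n$ minimizes $S_n$ over $\Theta$. Assume: * (A1) (Identifiability) for $\beta\in\Theta$: $E\|g(X_1,\beta)-g(X_1,\beta_0)\|^2=0\iff\beta=\beta_0$. * (A2) (Interior point) $\beta_0$ lies in the interior of $\Theta$. * (A3) (Smoothness) there is an open neighbourhood $U\subset\Theta$ of $\beta_0$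 such that, for almost every $x$ with respect to the law of $X_1$, $g(x,\cdot)$ is twice continuously differentiable on $U$. * (A4) (Moment conditions) $E\|\varepsilon_1\|^2<\infty$, together with the following conditions. * For the CLT: $E\|G_1(\beta_0)'\varepsilon_1\|^2<\infty$. * For the LLN near $\beta_0$: the function $\sup_{\beta\in U}\big\|\tfrac{\partial^2}{\partial\beta\,\partial\beta'}\|Y_1-g(X_1,\beta)\|^2\big\|$ is bounded by an integrable random variable. * For the LLN away from $\beta_0$: there are $k\in\mathbb N$ and a compact $K\subset\Theta$ such that $$k\,E\|\varepsilon_1\|^2<E\Big[\inf_{\beta\in\Theta\setminus K}\sum_{i=1}^k\|Y_i-g(X_i,\beta)\|^2\Big],$$ with $\inf\emptyset=+\infty$; this holds automatically if $\Theta$ is compact. * (A5) (Nonsingularity) $H=\operatorname{plim}_{n\to\infty}\frac1n\sum_{i=1}^n G_i(\beta_0)'G_i(\beta_0)$ exists and is positive definite. Then the limit $J=\operatorname{plim}_{n\to\infty}\frac1n\sum_{i=1}^n G_i(\beta_0)'\Omega_iG_i(\beta_0)$ exists and $$\sqrt n(\hat\beta-\beta_0)\xrightarrow{d}N(0,H^{-1}JH^{-1}).$$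 **Special case.** If the errors are homoscedastic, i.e. $\mathrm{Var}(\varepsilon_i\mid X_i)=\Sigma$ almost surely for all $i$ with a constant matrix $\Sigma$ (in particular, if $\varepsilon_i$ is independent of $X_i$ with $\mathrm{Var}(\varepsilon_i)=\Sigma$), then $H=E[G_i(\beta_0)'G_i(\beta_0)]$ and $J=E[G_i(\beta_0)'\Sigma G_i(\beta_0)]$. If in addition $\Sigma=\sigma^2I_m$, then $$\sqrt n(\hat\beta-\beta_0)\xrightarrow{d}N(0,\sigma^2H^{-1}).$$ -/

import Mathlib

open MeasureTheory ProbabilityTheory Filter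
open scoped Topology ENNReal Matrix

noncomputable section

namespace NLS

/-- The least squares criterion `S_n(β) = ∑_{i<n} ‖y_i - g(x_i, β)‖²` for data `(y_i, x_i)`
indexed from `0`. -/
def criterion {𝒳 : Type*} {p m : ℕ}
    (g : 𝒳 → EuclideanSpace ℝ (Fin p) → EuclideanSpace ℝ (Fin m))
    (y : ℕ → EuclideanSpace ℝ (Fin m)) (x : ℕ → 𝒳) (n : ℕ)
    (β : EuclideanSpace ℝ (Fin p)) : ℝ :=
  ∑ i ∈ Finset.range n, ‖y i - g (x i) β‖ ^ 2

/-- The `m × p` Jacobian matrix `∂g(x, β)/∂β'`: row `i`, column `j` holds `∂g_i/∂β_j`. -/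
def jacobian {𝒳 : Type*} {p m : ℕ}
    (g : 𝒳 → EuclideanSpace ℝ (Fin p) → EuclideanSpace ℝ (Fin m))
    (x : 𝒳) (β : EuclideanSpace ℝ (Fin p)) : Matrix (Fin m) (Fin p) ℝ :=
  Matrix.of fun i j => fderiv ℝ (g x) β (EuclideanSpace.single j 1) i

/-- The conditional covariance matrix `Var(e | X)` of a random vector `e` given the
σ-algebra generated by `X`, as a matrix-valued random variable:
`E[(e_j - E[e_j | X]) (e_k - E[e_k | X]) | X]`. -/
def condCov {Ω 𝒳 : Type*} [MeasurableSpace Ω] [MeasurableSpace 𝒳] {m : ℕ}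
    (P : Measure Ω) (e : Ω → EuclideanSpace ℝ (Fin m)) (X : Ω → 𝒳) (ω : Ω) :
    Matrix (Fin m) (Fin m) ℝ :=
  Matrix.of fun j k =>
    (P[fun ω' =>
        (e ω' j - (P[fun ω'' => e ω'' j | MeasurableSpace.comap X inferInstance]) ω') *
        (e ω' k - (P[fun ω'' => e ω'' k | MeasurableSpace.comap X inferInstance]) ω')
      | MeasurableSpace.comap X inferInstance]) ω

/-- `A = plim (1/n) ∑_{i<n} M_i` for random matrices `M_i`: (entrywise) convergence in
probability of the sample averages. -/
def IsPlimAverage {Ω : Type*} [MeasurableSpace Ω] {p : ℕ} (P : Measure Ω)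
    (M : ℕ → Ω → Matrix (Fin p) (Fin p) ℝ) (A : Matrix (Fin p) (Fin p) ℝ) : Prop :=
  ∀ j k, TendstoInMeasure P
    (fun (n : ℕ) ω => (n : ℝ)⁻¹ * ∑ i ∈ Finset.range n, M i ω j k) atTop (fun _ => A j k)

/-- `A = E[M]` for a random matrix `M`; the entries are required to be integrable. -/
def IsExpectation {Ω : Type*} [MeasurableSpace Ω] {p : ℕ} (P : Measure Ω)
    (M : Ω → Matrix (Fin p) (Fin p) ℝ) (A : Matrix (Fin p) (Fin p) ℝ) : Prop :=
  ∀ j k, Integrable (fun ω => M ω j k) P ∧ A j k = ∫ ω, M ω j k ∂P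

/-- `√n (b_n - β₀)` converges in distribution to `N(0, V)`, where `V` is a valid covariance matrix. -/
def AsymptoticallyNormal {Ω : Type*} [MeasurableSpace Ω] {p : ℕ} (P : Measure Ω)
    [IsProbabilityMeasure P] (b : ℕ → Ω → EuclideanSpace ℝ (Fin p))
    (β₀ : EuclideanSpace ℝ (Fin p)) (V : Matrix (Fin p) (Fin p) ℝ) : Prop :=
  V.PosSemidef ∧
  TendstoInDistribution (fun (n : ℕ) ω => √(n : ℝ) • (b n ω - β₀)) atTop id
    (fun _ => P) (multivariateGaussian 0 V)

end NLS

end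

/-!
Asymptotic normality of the nonlinear least squares estimator with i.i.d. data.

*Consistency* is Wald's argument. Since `E[ε | X] = 0`, Pythagoras gives
`E‖Y - g(X, β)‖² = E‖ε‖² + E‖g(X, β) - g(X, β₀)‖²`, so `β₀` is the unique minimizer of the expected
criterion (`lintegral_enorm_sq_lt_of_condExp`). By monotone convergence every `β ≠ β₀` has a ball
on which even the expected infimum of `‖Y - g(X, ·)‖²` exceeds `E‖ε‖²`; finitely many such balls
cover the compact set `K` minus a neighbourhood of `β₀`, and the law of large numbers rules each of
them out. Outside `K` the same argument is applied to disjoint blocks of `k` observations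
(`withHighProb_mem_of_isMinimizer`). These infima are nonnegative but possibly not integrable, so
they are bounded below by a one-sided law of large numbers, obtained by truncation
(`withHighProb_le_sum`).

*Linearization.* With high probability the estimator is an interior minimum, so the summed gradient
`∑ ∇q_i` of the squared residuals vanishes at it. The remainder
`∇q(β) - ∇q(β₀) - ∇²q(β₀)(β - β₀)` is `o(‖β - β₀‖)` for fixed data. The supremum of the ratio over
a shrinking ball is dominated, by the bound on the second derivatives, so it tends to zero in mean.
Together with the law of large numbers for `∇²q(β₀)` this gives
`E[∇²q(β₀)] (b_n - β₀) = -(1/n) ∑ ∇q_i(β₀) + o_P(‖b_n - β₀‖)` (`withHighProb_linearization`).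
Here `∇q_i(β₀) = -2 G_i'ε_i`, and `E[∇²q(β₀)] = 2 E[G'G] = 2H` because the term with the second
derivatives of `g` is a function of `X` multiplied by `ε`, and `E[ε | X] = 0`
(`integral_hessian_eq`); that `G'G` is integrable with mean `H` is a consequence of the convergence
in probability of its averages (`integrable_gram_of_isPlimAverage`).

*Limit law.* The scores `G_i'ε_i` are i.i.d., centred and square integrable, and the central limit
theorem for vectors follows from the one for real variables by characteristic functions. As the
error in the linearization is relative to `‖b_n - β₀‖` itself, it is absorbed without a separate
proof of the rate `√n` (`asymptoticallyNormal_of_linearization`). The middle matrix is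
`J = E[G'εε'G]`. By pulling `G` out of the conditional expectation,
`G_i' Var(ε_i | X_i) G_i = E[G_i'ε_i ε_i'G_i | X_i]`, so `J` is also the limit of the averages of
these matrices (`isPlimAverage_sandwich`); if `Var(ε_i | X_i) = S`, it is the mean of `G'SG`.
-/

namespace NLS

/-! ### Events of probability tending to one -/

/-- The events `Q n` hold with probability tending to one. The complements are measured by the
outer measure `P`, so no measurability of `Q n` is required. -/
def WithHighProb {Ω : Type*} [MeasurableSpace Ω] (P : Measure Ω) (Q : ℕ → Ω → Prop) : Prop :=
  Tendsto (fun n => P {ω | ¬ Q n ω}) atTop (𝓝 0)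

section WithHighProb

variable {Ω : Type*} [MeasurableSpace Ω] {P : Measure Ω} {Q R : ℕ → Ω → Prop}

lemma WithHighProb.mono (h : WithHighProb P Q)
    (hQR : ∀ᶠ n in atTop, ∀ᵐ ω ∂P, Q n ω → R n ω) : WithHighProb P R := by
  refine tendsto_of_tendsto_of_tendsto_of_le_of_le' tendsto_const_nhds h
    (Eventually.of_forall fun _ => zero_le) ?_
  filter_upwards [hQR] with n hn
  refine measure_mono_ae ?_
  filter_upwards [hn] with ω hω hR hQ
  exact hR (hω hQ)

lemma WithHighProb.and (hQ : WithHighProb P Q) (hR : WithHighProb P R) :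
    WithHighProb P fun n ω => Q n ω ∧ R n ω := by
  have h := Tendsto.add hQ hR
  rw [add_zero] at h
  refine tendsto_of_tendsto_of_tendsto_of_le_of_le tendsto_const_nhds h
    (fun _ => zero_le) fun n => ?_
  refine (measure_mono fun ω hω => ?_).trans (measure_union_le _ _)
  simp only [Set.mem_ofPred_eq, not_and_or] at hω
  exact hω

lemma withHighProb_of_forall (h : ∀ n ω, Q n ω) : WithHighProb P Q := by
  simp [WithHighProb, h]

lemma withHighProb_finset_forall {ι : Type*} (s : Finset ι) {Q : ι → ℕ → Ω → Prop}
    (h : ∀ i ∈ s, WithHighProb P (Q i)) : WithHighProb P fun n ω => ∀ i ∈ s, Q i n ω := by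
  classical
  induction s using Finset.induction_on with
  | empty => exact withHighProb_of_forall (by simp)
  | insert a s _ ih =>
    refine ((h a (by simp)).and (ih fun i hi => h i (by simp [hi]))).mono
      (Eventually.of_forall fun n => Eventually.of_forall fun ω hω => ?_)
    simpa using hω

lemma WithHighProb.exists [IsProbabilityMeasure P] (h : WithHighProb P Q) : ∃ n ω, Q n ω := by
  by_contra! hc
  have : (fun n => P {ω | ¬ Q n ω}) = fun _ => 1 := by
    funext n; simp [hc n]
  rw [WithHighProb, this] at h
  exact one_ne_zero (tendsto_nhds_unique tendsto_const_nhds h)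

lemma withHighProb_norm_sub_lt {E : Type*} [SeminormedAddCommGroup E] {f : ℕ → Ω → E} {g : Ω → E}
    (h : TendstoInMeasure P f atTop g) {δ : ℝ} (hδ : 0 < δ) :
    WithHighProb P fun n ω => ‖f n ω - g ω‖ < δ := by
  simpa [WithHighProb] using tendstoInMeasure_iff_norm.1 h δ hδ

lemma tendstoInMeasure_of_withHighProb {E : Type*} [SeminormedAddCommGroup E] {f : ℕ → Ω → E}
    {g : Ω → E} (h : ∀ δ > 0, WithHighProb P fun n ω => ‖f n ω - g ω‖ < δ) :
    TendstoInMeasure P f atTop g :=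
  tendstoInMeasure_iff_norm.2 fun δ hδ => by simpa [WithHighProb] using h δ hδ

end WithHighProb

/-! ### Laws of large numbers -/

section LLN

variable {Ω 𝒵 : Type*} [MeasurableSpace Ω] [MeasurableSpace 𝒵] {P : Measure Ω}
  {Z : ℕ → Ω → 𝒵}

/-- Weak law of large numbers for an integrable Banach-valued function of i.i.d. data. -/
lemma tendstoInMeasure_average [IsProbabilityMeasure P] {E : Type*} [NormedAddCommGroup E]
    [NormedSpace ℝ E] [CompleteSpace E] [MeasurableSpace E] [BorelSpace E]
    (hind : Pairwise fun i j => IndepFun (Z i) (Z j) P)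
    (hid : ∀ i, IdentDistrib (Z i) (Z 0) P P)
    {f : 𝒵 → E} (hf : Integrable f (P.map (Z 0))) :
    TendstoInMeasure P (fun (n : ℕ) ω => (n : ℝ)⁻¹ • ∑ i ∈ Finset.range n, f (Z i ω)) atTop
      (fun _ => ∫ z, f z ∂(P.map (Z 0))) := by
  have hmap : ∀ i, P.map (Z i) = P.map (Z 0) := fun i => (hid i).map_eq
  have hm : ∀ i, AEMeasurable (Z i) P := fun i => (hid i).aemeasurable_fst
  have hfi : ∀ i, Integrable (f ∘ Z i) P := fun i => by
    rw [← integrable_map_measure (by rw [hmap]; exact hf.1) (hm i), hmap]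
    exact hf
  have hfm : ∀ i, AEMeasurable f (P.map (Z i)) := fun i => by
    rw [hmap]; exact hf.1.aemeasurable
  refine tendstoInMeasure_of_tendsto_ae (fun n => ?_) ?_
  · exact (Finset.aestronglyMeasurable_fun_sum _ fun i _ => (hfi i).1).const_smul _
  · rw [integral_map (hm 0) hf.1]
    exact strong_law_ae (fun i => f ∘ Z i) (hfi 0)
      (fun i j hij => (hind hij).comp₀ (hm i) (hm j) (hfm i) (hfm j))
      (fun i => (hid i).comp_of_aemeasurable (hfm i))

lemma withHighProb_le_sum_of_integrable [IsProbabilityMeasure P]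
    (hind : Pairwise fun i j => IndepFun (Z i) (Z j) P)
    (hid : ∀ i, IdentDistrib (Z i) (Z 0) P P)
    {f : 𝒵 → ℝ} (hf : Integrable f (P.map (Z 0))) {c : ℝ}
    (hc : c < ∫ z, f z ∂(P.map (Z 0))) :
    WithHighProb P fun n ω => n * c ≤ ∑ i ∈ Finset.range n, f (Z i ω) := by
  have h := tendstoInMeasure_average hind hid hf
  refine (withHighProb_norm_sub_lt h (sub_pos.2 hc)).mono ?_
  filter_upwards [eventually_gt_atTop 0] with n hn
  refine Eventually.of_forall fun ω hω => ?_
  rw [Real.norm_eq_abs, abs_lt, smul_eq_mul] at hω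
  have h1 : c ≤ (n : ℝ)⁻¹ * ∑ i ∈ Finset.range n, f (Z i ω) := by linarith [hω.1]
  have hn' : (0 : ℝ) < n := by exact_mod_cast hn
  rw [inv_mul_eq_div, le_div_iff₀ hn'] at h1
  linarith

/-- One-sided law of large numbers, without integrability: averages of a nonnegative function
eventually exceed any number below the (possibly infinite) expectation. -/
lemma withHighProb_le_sum [IsProbabilityMeasure P]
    (hind : Pairwise fun i j => IndepFun (Z i) (Z j) P)
    (hid : ∀ i, IdentDistrib (Z i) (Z 0) P P)
    {F : 𝒵 → ℝ≥0∞} (hF : AEMeasurable F (P.map (Z 0))) {c : NNReal}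
    (hc : (c : ℝ≥0∞) < ∫⁻ z, F z ∂(P.map (Z 0))) :
    WithHighProb P fun n ω => (n : ℝ≥0∞) * c ≤ ∑ i ∈ Finset.range n, F (Z i ω) := by
  have hm : AEMeasurable (Z 0) P := (hid 0).aemeasurable_fst
  have : IsProbabilityMeasure (P.map (Z 0)) := Measure.isProbabilityMeasure_map hm
  -- truncate `F` at a level `N` that keeps the expectation above `c`
  obtain ⟨T, hTm, hTF, N, hTN, hcT⟩ : ∃ T : 𝒵 → ℝ≥0∞, AEMeasurable T (P.map (Z 0)) ∧
      (∀ z, T z ≤ F z) ∧ ∃ N : NNReal, (∀ z, T z ≤ N) ∧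
      (c : ℝ≥0∞) < ∫⁻ z, T z ∂(P.map (Z 0)) := by
    have hlim : Tendsto (fun N : ℕ => ∫⁻ z, min (F z) N ∂(P.map (Z 0))) atTop
        (𝓝 (∫⁻ z, F z ∂(P.map (Z 0)))) := by
      refine lintegral_tendsto_of_tendsto_of_monotone (fun N => hF.min aemeasurable_const)
        (Eventually.of_forall fun z a b hab => ?_) (Eventually.of_forall fun z => ?_)
      · exact min_le_min le_rfl (by exact_mod_cast hab)
      · have := (tendsto_const_nhds (x := F z)).min ENNReal.tendsto_nat_nhds_top
        simpa using this
    obtain ⟨N, hN⟩ := (hlim.eventually_const_lt hc).exists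
    exact ⟨fun z => min (F z) N, hF.min aemeasurable_const, fun z => min_le_left _ _, N,
      fun z => by simp, hN⟩
  have hfin : ∀ z, T z ≠ ∞ := fun z => ((hTN z).trans_lt ENNReal.coe_lt_top).ne
  have hfint : Integrable (fun z => (T z).toReal) (P.map (Z 0)) := by
    refine Integrable.of_bound hTm.ennreal_toReal.aestronglyMeasurable (N : ℝ)
      (Eventually.of_forall fun z => ?_)
    rw [Real.norm_of_nonneg ENNReal.toReal_nonneg]
    exact ENNReal.toReal_mono ENNReal.coe_ne_top (hTN z)
  have hcr : (c : ℝ) < ∫ z, (T z).toReal ∂(P.map (Z 0)) := by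
    rw [integral_toReal hTm (Eventually.of_forall fun z => (hfin z).lt_top)]
    have hb : ∫⁻ z, T z ∂(P.map (Z 0)) ≠ ∞ := by
      refine ((lintegral_mono hTN).trans_lt ?_).ne
      simp
    simpa using (ENNReal.toReal_lt_toReal ENNReal.coe_ne_top hb).2 hcT
  refine (withHighProb_le_sum_of_integrable hind hid hfint hcr).mono
    (Eventually.of_forall fun n => Eventually.of_forall fun ω h2 => ?_)
  have h3 := ENNReal.ofReal_le_ofReal h2
  rw [ENNReal.ofReal_mul (Nat.cast_nonneg n), ENNReal.ofReal_natCast, ENNReal.ofReal_coe_nnreal,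
    ENNReal.ofReal_sum_of_nonneg fun _ _ => ENNReal.toReal_nonneg] at h3
  refine h3.trans (Finset.sum_le_sum fun i _ => ?_)
  rw [ENNReal.ofReal_toReal (hfin _)]
  exact hTF _

/-- If the sample averages of a nonnegative function of i.i.d. data converge in probability to a
finite limit, then the function is integrable. -/
lemma integrable_of_tendstoInMeasure_average [IsProbabilityMeasure P]
    (hind : Pairwise fun i j => IndepFun (Z i) (Z j) P)
    (hid : ∀ i, IdentDistrib (Z i) (Z 0) P P)
    {f : 𝒵 → ℝ} (hf : AEStronglyMeasurable f (P.map (Z 0))) (hf0 : ∀ z, 0 ≤ f z) {c : ℝ}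
    (h : TendstoInMeasure P (fun (n : ℕ) ω => (n : ℝ)⁻¹ * ∑ i ∈ Finset.range n, f (Z i ω)) atTop
      (fun _ => c)) :
    Integrable f (P.map (Z 0)) := by
  refine ⟨hf, ?_⟩
  rw [hasFiniteIntegral_iff_ofReal (Eventually.of_forall hf0)]
  by_contra htop
  rw [not_lt, top_le_iff] at htop
  have h1 := withHighProb_le_sum hind hid (c := (c + 1).toNNReal)
    hf.aemeasurable.ennreal_ofReal (by rw [htop]; exact ENNReal.coe_lt_top)
  have h2 := (h1.and (withHighProb_norm_sub_lt h one_pos)).mono (R := fun n ω => False) ?_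
  · obtain ⟨n, ω, h⟩ := h2.exists
    exact h
  filter_upwards [eventually_gt_atTop 0] with n hn
  refine Eventually.of_forall fun ω ⟨hω, hω2⟩ => ?_
  have hn' : (0 : ℝ) < n := by exact_mod_cast hn
  rw [← ENNReal.ofReal_sum_of_nonneg fun _ _ => hf0 _, ENNReal.ofNNReal_toNNReal,
    ← ENNReal.ofReal_natCast, ← ENNReal.ofReal_mul hn'.le,
    ENNReal.ofReal_le_ofReal_iff (Finset.sum_nonneg fun _ _ => hf0 _)] at hω
  rw [Real.norm_eq_abs, abs_lt, inv_mul_eq_div] at hω2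
  have := (le_div_iff₀ hn').2 ((mul_comm _ _).trans_le hω)
  linarith [hω2.2]

/-- Consecutive blocks of length `k` of an i.i.d. sequence are again i.i.d. (independence is only
recorded pairwise, which is what the law of large numbers needs). -/
lemma pairwise_indepFun_blocks (hind : iIndepFun Z P) (hm : ∀ i, Measurable (Z i)) (k : ℕ) :
    Pairwise fun i j => IndepFun (fun ω (l : Fin k) => Z (i * k + l) ω)
      (fun ω (l : Fin k) => Z (j * k + l) ω) P := by
  intro i j hij
  let S : ℕ → Finset ℕ := fun i => Finset.univ.image fun l : Fin k => i * k + (l : ℕ)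
  have hmem : ∀ i (l : Fin k), i * k + (l : ℕ) ∈ S i := fun i l =>
    Finset.mem_image_of_mem _ (Finset.mem_univ l)
  have hdisj : Disjoint (S i) (S j) := by
    rw [Finset.disjoint_left]
    intro a ha hb
    simp only [S, Finset.mem_image, Finset.mem_univ, true_and] at ha hb
    obtain ⟨l, rfl⟩ := ha
    obtain ⟨l', hl'⟩ := hb
    apply hij
    have h1 : (i * k + (l : ℕ)) / k = i := by
      rw [mul_comm, Nat.mul_add_div (by have := l.2; omega), Nat.div_eq_of_lt l.2, add_zero]
    have h2 : (j * k + (l' : ℕ)) / k = j := by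
      rw [mul_comm, Nat.mul_add_div (by have := l.2; omega), Nat.div_eq_of_lt l'.2, add_zero]
    rw [← h1, ← h2, hl']
  have h := hind.indepFun_finset (S i) (S j) hdisj hm
  exact h.comp (φ := fun z (l : Fin k) => z ⟨i * k + l, hmem i l⟩)
    (ψ := fun z (l : Fin k) => z ⟨j * k + l, hmem j l⟩)
    (measurable_pi_lambda _ fun l => measurable_pi_apply _)
    (measurable_pi_lambda _ fun l => measurable_pi_apply _)

lemma identDistrib_blocks [IsProbabilityMeasure P] (hind : iIndepFun Z P)
    (hm : ∀ i, Measurable (Z i))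
    (hid : ∀ i, IdentDistrib (Z i) (Z 0) P P) (k i : ℕ) :
    IdentDistrib (fun ω (l : Fin k) => Z (i * k + l) ω) (fun ω (l : Fin k) => Z (0 * k + l) ω)
      P P := by
  have hb : ∀ i, iIndepFun (fun (l : Fin k) => Z (i * k + l)) P := fun i =>
    hind.precomp (g := fun l : Fin k => i * k + (l : ℕ))
      fun a b hab => Fin.ext (by simpa using hab)
  refine ⟨(measurable_pi_lambda _ fun l => hm _).aemeasurable,
    (measurable_pi_lambda _ fun l => hm _).aemeasurable, ?_⟩
  rw [(iIndepFun_iff_map_fun_eq_pi_map fun l => (hm _).aemeasurable).1 (hb i),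
    (iIndepFun_iff_map_fun_eq_pi_map fun l => (hm _).aemeasurable).1 (hb 0)]
  simp only [fun i => (hid i).map_eq]

end LLN

/-! ### The multivariate central limit theorem -/

section CLT

variable {Ω : Type*} [MeasurableSpace Ω] {P : Measure Ω} {p : ℕ}

lemma dotProduct_mulVec_secondMoment {X : Ω → EuclideanSpace ℝ (Fin p)} (hX : MemLp X 2 P)
    (t : EuclideanSpace ℝ (Fin p)) :
    t ⬝ᵥ (Matrix.of fun j k => ∫ ω, X ω j * X ω k ∂P) *ᵥ t = ∫ ω, (inner ℝ t (X ω)) ^ 2 ∂P := by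
  have hXj : ∀ j, MemLp (fun ω => X ω j) 2 P := fun j =>
    (EuclideanSpace.proj j : EuclideanSpace ℝ (Fin p) →L[ℝ] ℝ).comp_memLp' hX
  have hint : ∀ j k, Integrable (fun ω => X ω j * X ω k) P := fun j k =>
    (hXj j).integrable_mul (hXj k)
  have : ∀ ω, (inner ℝ t (X ω)) ^ 2 = ∑ j, ∑ k, t j * t k * (X ω j * X ω k) := fun ω => by
    rw [PiLp.inner_apply, sq, Finset.sum_mul_sum]
    refine Finset.sum_congr rfl fun j _ => Finset.sum_congr rfl fun k _ => ?_
    simp only [RCLike.inner_apply, conj_trivial]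
    ring
  simp_rw [this]
  rw [integral_finsetSum _ fun j _ => integrable_finsetSum _ fun k _ => (hint j k).const_mul _]
  simp only [dotProduct, Matrix.mulVec, Matrix.of_apply, Finset.mul_sum]
  refine Finset.sum_congr rfl fun j _ => ?_
  rw [integral_finsetSum _ fun k _ => (hint j k).const_mul _]
  refine Finset.sum_congr rfl fun k _ => ?_
  rw [integral_const_mul]
  ring

lemma posSemidef_secondMoment {X : Ω → EuclideanSpace ℝ (Fin p)} (hX : MemLp X 2 P) :
    (Matrix.of fun j k => ∫ ω, X ω j * X ω k ∂P).PosSemidef := by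
  refine Matrix.PosSemidef.of_dotProduct_mulVec_nonneg ?_ fun x => ?_
  · ext j k
    simp [mul_comm]
  · have := dotProduct_mulVec_secondMoment hX (WithLp.toLp 2 x)
    simp only [star_trivial]
    rw [this]
    exact integral_nonneg fun _ => sq_nonneg _

/-- Multivariate central limit theorem for centred i.i.d. random vectors, by the Cramér–Wold
device: the characteristic function of a normalized sum at `t` is the one of its projection on `t`
at `1`, to which the one-dimensional theorem applies. -/
theorem tendstoInDistribution_inv_sqrt_smul_sum [IsProbabilityMeasure P]
    {X : ℕ → Ω → EuclideanSpace ℝ (Fin p)}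
    (hX : MemLp (X 0) 2 P) (h0 : ∫ ω, X 0 ω ∂P = 0) (hind : iIndepFun X P)
    (hid : ∀ i, IdentDistrib (X i) (X 0) P P) :
    TendstoInDistribution (fun (n : ℕ) ω => (√(n : ℝ))⁻¹ • ∑ i ∈ Finset.range n, X i ω) atTop id
      (fun _ => P) (multivariateGaussian 0 (Matrix.of fun j k => ∫ ω, X 0 ω j * X 0 ω k ∂P)) where
  forall_aemeasurable n := by
    have hm : ∀ i, AEMeasurable (X i) P := fun i => (hid i).aemeasurable_fst
    fun_prop
  aemeasurable_limit := aemeasurable_id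
  tendsto := by
    have hm : ∀ i, AEMeasurable (X i) P := fun i => (hid i).aemeasurable_fst
    refine ProbabilityMeasure.tendsto_iff_tendsto_charFun.2 fun t => ?_
    have hmt : Measurable fun x : EuclideanSpace ℝ (Fin p) => inner ℝ t x := by fun_prop
    have hmean : ∫ ω, inner ℝ t (X 0 ω) ∂P = 0 := by
      rw [integral_inner (hX.integrable (by norm_num)), h0, inner_zero_right]
    have hL2 : MemLp (fun ω => inner ℝ t (X 0 ω)) 2 P := (innerSL ℝ t).comp_memLp' hX
    have hvar : Var[fun ω => inner ℝ t (X 0 ω); P] = ∫ ω, (inner ℝ t (X 0 ω)) ^ 2 ∂P := by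
      rw [variance_eq_sub hL2, hmean]
      simp
    have hclt := tendstoInDistribution_inv_sqrt_mul_sum_sub
      (P := P) (X := fun i ω => inner ℝ t (X i ω)) (Y := id)
      (P' := gaussianReal 0 (Var[fun ω => inner ℝ t (X 0 ω); P]).toNNReal)
      ⟨aemeasurable_id, by simp⟩ hL2 (hind.comp (fun _ => fun x => inner ℝ t x) fun _ => hmt)
      (fun i => (hid i).comp hmt)
    have h1 := ProbabilityMeasure.tendsto_iff_tendsto_charFun.1 hclt.tendsto 1
    simp only [ProbabilityMeasure.coe_mk, Measure.map_id, charFun_gaussianReal] at h1 ⊢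
    rw [charFun_multivariateGaussian (posSemidef_secondMoment hX),
      dotProduct_mulVec_secondMoment hX]
    convert h1 using 2
    · rename_i n
      have hs : AEMeasurable (fun ω => (√(n : ℝ))⁻¹ • ∑ i ∈ Finset.range n, X i ω) P := by
        fun_prop
      rw [charFun_apply, charFun_apply_real, integral_map hs (by fun_prop),
        integral_map (by fun_prop) (by fun_prop)]
      refine integral_congr_ae (Eventually.of_forall fun ω => ?_)
      simp only [hmean]
      rw [real_inner_comm, inner_smul_right, inner_sum]
      simp
    · rw [hvar]
      simp only [inner_zero_right]
      rw [Real.coe_toNNReal _ (integral_nonneg fun _ => sq_nonneg _)]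
      simp

end CLT

/-! ### Consistency of minimum contrast estimators -/

section Consistency

lemma WithHighProb.comp_tendsto {Ω : Type*} [MeasurableSpace Ω] {P : Measure Ω}
    {Q : ℕ → Ω → Prop} (h : WithHighProb P Q) {u : ℕ → ℕ} (hu : Tendsto u atTop atTop) :
    WithHighProb P fun n => Q (u n) :=
  Tendsto.comp (g := fun n => P {ω | ¬ Q n ω}) h hu

lemma exists_countable_biInf_eq {E : Type*} [PseudoMetricSpace E] [SecondCountableTopology E]
    (A : Set E) : ∃ s ⊆ A, s.Countable ∧ ∀ f : E → ℝ≥0∞, ContinuousOn f A →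
      ⨅ β ∈ A, f β = ⨅ β ∈ s, f β := by
  obtain ⟨s, hsA, hsc, hAs⟩ :=
    (TopologicalSpace.IsSeparable.of_separableSpace A).exists_countable_dense_subset
  refine ⟨s, hsA, hsc, fun f hf => le_antisymm (biInf_mono hsA) ?_⟩
  refine le_iInf₂ fun β hβ => ?_
  have hne : (𝓝[s] β).NeBot := mem_closure_iff_nhdsWithin_neBot.1 (hAs hβ)
  refine ge_of_tendsto ((hf β hβ).mono_left (nhdsWithin_mono β hsA)) ?_
  filter_upwards [self_mem_nhdsWithin] with β' hβ'
  exact iInf₂_le β' hβ'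

lemma measurable_biInf_of_continuousOn {E 𝒵 : Type*} [PseudoMetricSpace E]
    [SecondCountableTopology E] [MeasurableSpace 𝒵] {A : Set E} {q : 𝒵 → E → ℝ≥0∞}
    (hqm : ∀ β ∈ A, Measurable fun z => q z β) (hqc : ∀ z, ContinuousOn (q z) A) :
    Measurable fun z => ⨅ β ∈ A, q z β := by
  obtain ⟨s, hsA, hsc, hs⟩ := exists_countable_biInf_eq A
  simp_rw [fun z => hs (q z) (hqc z)]
  exact Measurable.biInf s hsc fun β hβ => hqm β (hsA hβ)

lemma sum_range_mul_eq_sum_blocks {M : Type*} [AddCommMonoid M] (a : ℕ → M) (m k : ℕ) :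
    ∑ i ∈ Finset.range (m * k), a i =
      ∑ j ∈ Finset.range m, ∑ l ∈ Finset.range k, a (j * k + l) := by
  induction m with
  | zero => simp
  | succ m ih => rw [Nat.succ_mul, Finset.sum_range_add, ih, Finset.sum_range_succ]

variable {Ω 𝒵 E : Type*} [MeasurableSpace Ω] [MeasurableSpace 𝒵] [PseudoMetricSpace E]
  [SecondCountableTopology E] {P : Measure Ω} [IsProbabilityMeasure P] {Z : ℕ → Ω → 𝒵}
  {q : 𝒵 → E → ℝ≥0∞} {β₀ : E}

/-- If the expected infimum over `A` of the contrast of a block of `k` observations exceeds the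
expected contrast of the block at `β₀`, then with probability tending to one the contrast of the
whole sample at `β₀` is smaller than at any point of `A`: cut the sample into blocks, bound the
infimum of the sum below by the sum of the infima, and apply the law of large numbers. -/
lemma withHighProb_forall_lt_of_block (hind : iIndepFun Z P) (hZ : ∀ i, Measurable (Z i))
    (hid : ∀ i, IdentDistrib (Z i) (Z 0) P P) {A : Set E}
    (hqm : ∀ β ∈ A, Measurable fun z => q z β) (hqc : ∀ z, ContinuousOn (q z) A)
    (hm₀ : Measurable fun z => q z β₀) (hfin : ∀ z, q z β₀ ≠ ∞)
    (h₀ : ∫⁻ ω, q (Z 0 ω) β₀ ∂P ≠ ∞) {k : ℕ}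
    (hk : (k : ℝ≥0∞) * ∫⁻ ω, q (Z 0 ω) β₀ ∂P <
      ∫⁻ ω, ⨅ β ∈ A, ∑ i ∈ Finset.range k, q (Z i ω) β ∂P) :
    WithHighProb P fun n ω => ∀ β ∈ A,
      ∑ i ∈ Finset.range n, q (Z i ω) β₀ < ∑ i ∈ Finset.range n, q (Z i ω) β := by
  rcases A.eq_empty_or_nonempty with rfl | ⟨a, ha⟩
  · exact withHighProb_of_forall (by simp)
  -- for `k = 0` the infimum over the nonempty set `A` would vanish
  have hk0 : 0 < k := by
    rcases Nat.eq_zero_or_pos k with rfl | h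
    · exfalso
      have : ∀ ω : Ω, ⨅ β ∈ A, ∑ i ∈ Finset.range 0, q (Z i ω) β = 0 := fun ω =>
        le_antisymm ((iInf₂_le a ha).trans (by simp)) zero_le
      simp only [this] at hk
      simp at hk
    · exact h
  have hkR : (0 : ℝ) < k := by exact_mod_cast hk0
  let W : ℕ → Ω → (Fin k → 𝒵) := fun j ω l => Z (j * k + l) ω
  let F : (Fin k → 𝒵) → ℝ≥0∞ := fun w => ⨅ β ∈ A, ∑ l, q (w l) β
  have hF : Measurable F := by
    refine measurable_biInf_of_continuousOn (q := fun (w : Fin k → 𝒵) β => ∑ l, q (w l) β)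
      (fun β hβ => ?_) (fun w => ?_)
    · exact Finset.measurable_fun_sum _ fun l _ => (hqm β hβ).comp (measurable_pi_apply l)
    · exact continuousOn_finsetSum _ fun l _ => hqc _
  have hWm : ∀ j, Measurable (W j) := fun j => measurable_pi_lambda _ fun l => hZ _
  have hFW : ∫⁻ w, F w ∂(P.map (W 0)) =
      ∫⁻ ω, ⨅ β ∈ A, ∑ i ∈ Finset.range k, q (Z i ω) β ∂P := by
    rw [lintegral_map hF (hWm 0)]
    refine lintegral_congr fun ω => ?_
    simp only [F, W, Finset.sum_range, zero_mul, zero_add]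
  rw [← hFW] at hk
  -- numbers `d` and `c` with `E q(β₀) < d` and `k d < c < E F`
  obtain ⟨c, hc1, hc2⟩ := ENNReal.lt_iff_exists_nnreal_btwn.1 hk
  set e := (∫⁻ ω, q (Z 0 ω) β₀ ∂P).toReal with he
  have hec : k * e < c := by
    have := (ENNReal.toReal_lt_toReal (ENNReal.mul_ne_top (by simp) h₀) ENNReal.coe_ne_top).2 hc1
    simpa [ENNReal.toReal_mul] using this
  obtain ⟨d, hd1, hd2⟩ := exists_between ((lt_div_iff₀' hkR).2 hec)
  rw [lt_div_iff₀' hkR] at hd2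
  have hd0 : 0 ≤ d := ENNReal.toReal_nonneg.trans hd1.le
  have h1 : WithHighProb P fun m ω => (m : ℝ≥0∞) * c ≤ ∑ j ∈ Finset.range m, F (W j ω) :=
    withHighProb_le_sum (pairwise_indepFun_blocks hind hZ k)
      (identDistrib_blocks hind hZ hid k) hF.aemeasurable hc2
  have hint : Integrable (fun z => (q z β₀).toReal) (P.map (Z 0)) :=
    integrable_toReal_of_lintegral_ne_top hm₀.aemeasurable
      (by rwa [lintegral_map hm₀ (hZ 0)])
  have h2 : WithHighProb P fun n ω =>
      n * (-d) ≤ ∑ i ∈ Finset.range n, -(q (Z i ω) β₀).toReal := by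
    refine withHighProb_le_sum_of_integrable (fun i j hij => hind.indepFun hij) hid hint.neg ?_
    have : ∫ z, -(q z β₀).toReal ∂(P.map (Z 0)) = -e := by
      rw [integral_neg, integral_toReal hm₀.aemeasurable
        (Eventually.of_forall fun z => (hfin z).lt_top), lintegral_map hm₀ (hZ 0)]
    exact (neg_lt_neg hd1).trans_eq this.symm
  have hdiv : Tendsto (fun n : ℕ => n / k) atTop atTop := Nat.tendsto_div_const_atTop hk0.ne'
  refine ((h1.comp_tendsto hdiv).and h2).mono ?_
  have hlarge : ∀ᶠ n : ℕ in atTop, k * d < ((n / k : ℕ) : ℝ) * (c - k * d) :=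
    ((tendsto_natCast_atTop_atTop.comp hdiv).atTop_mul_const (sub_pos.2 hd2)).eventually_gt_atTop _
  filter_upwards [hlarge] with n hn
  refine Eventually.of_forall fun ω ⟨hω1, hω2⟩ β hβ => ?_
  have hlt : (n : ℝ) * d < ((n / k : ℕ) : ℝ) * c := by
    have : (n : ℝ) ≤ ((n / k : ℕ) + 1) * k := by
      have := (Nat.lt_mul_div_succ n hk0).le
      rw [mul_comm] at this
      exact_mod_cast this
    nlinarith [mul_le_mul_of_nonneg_right this hd0]
  calc ∑ i ∈ Finset.range n, q (Z i ω) β₀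
      = ENNReal.ofReal (∑ i ∈ Finset.range n, (q (Z i ω) β₀).toReal) := by
        rw [ENNReal.ofReal_sum_of_nonneg fun _ _ => ENNReal.toReal_nonneg]
        exact Finset.sum_congr rfl fun i _ => (ENNReal.ofReal_toReal (hfin _)).symm
    _ ≤ ENNReal.ofReal (n * d) := by
        refine ENNReal.ofReal_le_ofReal ?_
        rw [Finset.sum_neg_distrib] at hω2
        linarith
    _ < ENNReal.ofReal (((n / k : ℕ) : ℝ) * c) := by
        rw [ENNReal.ofReal_lt_ofReal_iff_of_nonneg (by positivity)]
        exact hlt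
    _ = ((n / k : ℕ) : ℝ≥0∞) * c := by
        rw [ENNReal.ofReal_mul (Nat.cast_nonneg _), ENNReal.ofReal_natCast,
          ENNReal.ofReal_coe_nnreal]
    _ ≤ ∑ j ∈ Finset.range (n / k), F (W j ω) := hω1
    _ ≤ ∑ j ∈ Finset.range (n / k), ∑ l ∈ Finset.range k, q (Z (j * k + l) ω) β := by
        refine Finset.sum_le_sum fun j _ => (iInf₂_le β hβ).trans_eq ?_
        rw [Finset.sum_range]
    _ = ∑ i ∈ Finset.range (n / k * k), q (Z i ω) β :=
        (sum_range_mul_eq_sum_blocks (fun i => q (Z i ω) β) (n / k) k).symm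
    _ ≤ ∑ i ∈ Finset.range n, q (Z i ω) β :=
        Finset.sum_le_sum_of_subset (Finset.range_mono (Nat.div_mul_le_self n k))

omit [IsProbabilityMeasure P] in
/-- By monotone convergence, a strict lower bound for the expected contrast at `β` persists for
the expected infimum of the contrast over a small ball. -/
lemma exists_ball_lt_lintegral_biInf {Θ : Set E} {X : Ω → 𝒵} (hX : Measurable X)
    (hqm : ∀ β ∈ Θ, Measurable fun z => q z β) (hqc : ∀ z, ContinuousOn (q z) Θ) {β : E}
    (hβ : β ∈ Θ) {c : ℝ≥0∞} (hc : c < ∫⁻ ω, q (X ω) β ∂P) :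
    ∃ r > 0, c < ∫⁻ ω, ⨅ β' ∈ Θ ∩ Metric.ball β r, q (X ω) β' ∂P := by
  have hlim : Tendsto (fun n : ℕ => ∫⁻ ω, ⨅ β' ∈ Θ ∩ Metric.ball β (1 / ((n : ℝ) + 1)),
      q (X ω) β' ∂P) atTop (𝓝 (∫⁻ ω, q (X ω) β ∂P)) := by
    refine lintegral_tendsto_of_tendsto_of_monotone (fun n => ?_)
      (Eventually.of_forall fun ω a b hab => ?_) (Eventually.of_forall fun ω => ?_)
    · exact ((measurable_biInf_of_continuousOn (fun β hβ => hqm β hβ.1)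
        fun z => (hqc z).mono Set.inter_subset_left).comp hX).aemeasurable
    · exact biInf_mono (Set.inter_subset_inter_right _
        (Metric.ball_subset_ball (Nat.one_div_le_one_div hab)))
    · refine tendsto_order.2 ⟨fun a' ha' => ?_, fun a' ha' => Eventually.of_forall fun n => ?_⟩
      · obtain ⟨a, ha1, ha2⟩ := exists_between ha'
        have := (hqc (X ω) β hβ).eventually_const_lt ha2
        obtain ⟨r, hr, hsub⟩ := Metric.mem_nhdsWithin_iff.1 this
        have hn : ∀ᶠ n : ℕ in atTop, 1 / ((n : ℝ) + 1) < r :=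
          tendsto_one_div_add_atTop_nhds_zero_nat.eventually_lt_const hr
        filter_upwards [hn] with n hn
        refine ha1.trans_le (le_iInf₂ fun β' hβ' => ?_)
        exact le_of_lt (hsub ⟨Metric.ball_subset_ball hn.le hβ'.2, hβ'.1⟩)
      · exact (iInf₂_le β ⟨hβ, Metric.mem_ball_self (by positivity)⟩).trans_lt ha'
  obtain ⟨n, hn⟩ := (hlim.eventually_const_lt hc).exists
  exact ⟨1 / ((n : ℝ) + 1), by positivity, hn⟩

/-- Wald-type consistency: if the expected contrast is uniquely minimal at `β₀` and the contrast
is controlled outside a compact set `K` through blocks of `k` observations, then a minimizer over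
`Θ` lies in any given neighbourhood of `β₀` with probability tending to one. -/
theorem withHighProb_mem_of_isMinimizer (hind : iIndepFun Z P) (hZ : ∀ i, Measurable (Z i))
    (hid : ∀ i, IdentDistrib (Z i) (Z 0) P P) {Θ : Set E}
    (hqm : ∀ β ∈ Θ, Measurable fun z => q z β) (hqc : ∀ z, ContinuousOn (q z) Θ)
    (hβ₀ : β₀ ∈ Θ) (hfin : ∀ z, q z β₀ ≠ ∞) (h₀ : ∫⁻ ω, q (Z 0 ω) β₀ ∂P ≠ ∞)
    (hsep : ∀ β ∈ Θ, β ≠ β₀ → ∫⁻ ω, q (Z 0 ω) β₀ ∂P < ∫⁻ ω, q (Z 0 ω) β ∂P)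
    {k : ℕ} {K : Set E} (hKΘ : K ⊆ Θ) (hK : IsCompact K)
    (hk : (k : ℝ≥0∞) * ∫⁻ ω, q (Z 0 ω) β₀ ∂P <
      ∫⁻ ω, ⨅ β ∈ Θ \ K, ∑ i ∈ Finset.range k, q (Z i ω) β ∂P)
    {b : ℕ → Ω → E}
    (hb : WithHighProb P fun n ω => b n ω ∈ Θ ∧ ∀ β ∈ Θ,
      ∑ i ∈ Finset.range n, q (Z i ω) (b n ω) ≤ ∑ i ∈ Finset.range n, q (Z i ω) β)
    {V : Set E} (hV : V ∈ 𝓝 β₀) : WithHighProb P fun n ω => b n ω ∈ V := by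
  have hm₀ := hqm β₀ hβ₀
  have hball : ∀ β : E, ∃ r > 0, β ∈ K → β ≠ β₀ → ∫⁻ ω, q (Z 0 ω) β₀ ∂P <
      ∫⁻ ω, ⨅ β' ∈ Θ ∩ Metric.ball β r, q (Z 0 ω) β' ∂P := fun β => by
    by_cases h : β ∈ K ∧ β ≠ β₀
    · obtain ⟨r, hr, h'⟩ := exists_ball_lt_lintegral_biInf (hZ 0) hqm hqc (hKΘ h.1)
        (hsep β (hKΘ h.1) h.2)
      exact ⟨r, hr, fun _ _ => h'⟩
    · exact ⟨1, one_pos, fun h1 h2 => absurd ⟨h1, h2⟩ h⟩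
  choose r hr hball using hball
  obtain ⟨t, htK, hcover⟩ := (hK.diff (isOpen_interior (s := V))).elim_nhds_subcover
    (fun β => Metric.ball β (r β)) (fun β _ => Metric.ball_mem_nhds β (hr β))
  have h1 : WithHighProb P fun n ω => ∀ β ∈ t, ∀ β' ∈ Θ ∩ Metric.ball β (r β),
      ∑ i ∈ Finset.range n, q (Z i ω) β₀ < ∑ i ∈ Finset.range n, q (Z i ω) β' := by
    refine withHighProb_finset_forall t fun β hβ => ?_
    have hβ' := htK β hβ
    refine withHighProb_forall_lt_of_block hind hZ hid (fun β hβ => hqm β hβ.1)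
      (fun z => (hqc z).mono Set.inter_subset_left) hm₀ hfin h₀ (k := 1) ?_
    simp only [Nat.cast_one, one_mul, Finset.sum_range_one]
    refine hball β hβ'.1 ?_
    exact fun h => hβ'.2 (mem_interior_iff_mem_nhds.2 (h ▸ hV))
  have h2 := withHighProb_forall_lt_of_block hind hZ hid (A := Θ \ K) (fun β hβ => hqm β hβ.1)
      (fun z => (hqc z).mono Set.sdiff_subset) hm₀ hfin h₀ hk
  refine ((h1.and h2).and hb).mono (Eventually.of_forall fun n => Eventually.of_forall
    fun ω ⟨⟨hω1, hω2⟩, hbΘ, hbmin⟩ => ?_)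
  by_contra hbV
  have hmin := hbmin β₀ hβ₀
  by_cases hbK : b n ω ∈ K
  · obtain ⟨β, hβt, hβ⟩ := Set.mem_iUnion₂.1
      (hcover ⟨hbK, fun h => hbV (interior_subset h)⟩)
    exact absurd hmin (not_le.2 (hω1 β hβt _ ⟨hbΘ, hβ⟩))
  · exact absurd hmin (not_le.2 (hω2 _ ⟨hbΘ, hbK⟩))

end Consistency

/-! ### Derivatives depending measurably on a parameter -/

section Derivative

variable {Ω 𝒵 F : Type*} [MeasurableSpace Ω] [MeasurableSpace 𝒵] {p : ℕ}
  [NormedAddCommGroup F] [NormedSpace ℝ F]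

lemma clm_eq_sum_smulRight (L : EuclideanSpace ℝ (Fin p) →L[ℝ] F) :
    L = ∑ j, (EuclideanSpace.proj j : EuclideanSpace ℝ (Fin p) →L[ℝ] ℝ).smulRight
      (L (EuclideanSpace.single j 1)) := by
  ext v
  have hv : v = ∑ j, v j • EuclideanSpace.single j (1 : ℝ) := by
    ext i
    simp [Finset.sum_apply, Pi.single_apply]
  conv_lhs => rw [hv]
  simp

lemma aestronglyMeasurable_fderiv {μ : Measure 𝒵} {f : 𝒵 → EuclideanSpace ℝ (Fin p) → F}
    {U : Set (EuclideanSpace ℝ (Fin p))} {β : EuclideanSpace ℝ (Fin p)} (hU : U ∈ 𝓝 β)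
    (hf : ∀ β' ∈ U, AEStronglyMeasurable (fun z => f z β') μ)
    (hd : ∀ᵐ z ∂μ, DifferentiableAt ℝ (f z) β) :
    AEStronglyMeasurable (fun z => fderiv ℝ (f z) β) μ := by
  have hv : ∀ v, AEStronglyMeasurable (fun z => fderiv ℝ (f z) β v) μ := fun v => by
    -- the derivative along `v` is a limit of difference quotients taken inside `U`
    have h0 : Tendsto (fun n : ℕ => β + ((n : ℝ))⁻¹ • v) atTop (𝓝 β) := by
      have := (tendsto_inv_atTop_zero.comp (tendsto_natCast_atTop_atTop (R := ℝ))).smul_const v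
      simpa using this.const_add β
    obtain ⟨N, hN⟩ := eventually_atTop.1 (h0.eventually hU)
    have hc : Tendsto (fun n : ℕ => ‖((n + N : ℕ) : ℝ)‖) atTop atTop :=
      tendsto_norm_atTop_atTop.comp
        (tendsto_natCast_atTop_atTop.comp (tendsto_add_atTop_nat N))
    refine aestronglyMeasurable_of_tendsto_ae atTop
      (f := fun n z => ((n + N : ℕ) : ℝ) • (f z (β + (((n + N : ℕ) : ℝ))⁻¹ • v) - f z β))
      (fun n => ?_) ?_
    · exact ((hf _ (hN _ (Nat.le_add_left N n))).sub (hf _ (mem_of_mem_nhds hU))).const_smul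
        ((n + N : ℕ) : ℝ)
    · filter_upwards [hd] with z hz
      exact hz.hasFDerivAt.lim v hc
  have : (fun z => fderiv ℝ (f z) β) = fun z =>
      ∑ j, ContinuousLinearMap.smulRightL ℝ (EuclideanSpace ℝ (Fin p)) F
        (EuclideanSpace.proj j : EuclideanSpace ℝ (Fin p) →L[ℝ] ℝ)
        (fderiv ℝ (f z) β (EuclideanSpace.single j 1)) := by
    funext z
    rw [clm_eq_sum_smulRight (fderiv ℝ (f z) β)]
    simp
  rw [this]
  exact Finset.aestronglyMeasurable_fun_sum _ fun j _ =>
    (ContinuousLinearMap.continuous _).comp_aestronglyMeasurable (hv _)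

/-- A first-order expansion at `β₀` with a random remainder coefficient `w` of arbitrarily small
expectation, valid uniformly on a fixed ball. The coefficient is the supremum over the ball of the
relative error of the expansion; it tends to zero with the radius and is dominated by the bound on
the derivative. -/
lemma exists_integrable_remainder {X : Ω → 𝒵} {P : Measure Ω} (hX : Measurable X)
    {f : 𝒵 → EuclideanSpace ℝ (Fin p) → F}
    {U : Set (EuclideanSpace ℝ (Fin p))} {β₀ : EuclideanSpace ℝ (Fin p)} (hU : U ∈ 𝓝 β₀)
    (hf : ∀ β ∈ U, AEStronglyMeasurable (fun z => f z β) (P.map X))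
    (hd : ∀ᵐ z ∂(P.map X), ∀ β ∈ U, DifferentiableAt ℝ (f z) β)
    {M : Ω → ℝ} (hM : Integrable M P)
    (hbound : ∀ᵐ ω ∂P, ∀ β ∈ U, ‖fderiv ℝ (f (X ω)) β‖ ≤ M ω) {η : ℝ} (hη : 0 < η) :
    ∃ r > 0, ∃ w : 𝒵 → ℝ, Integrable w (P.map X) ∧ ∫ z, w z ∂(P.map X) < η ∧
      ∀ᵐ z ∂(P.map X), ∀ β ∈ Metric.ball β₀ r,
        ‖f z β - f z β₀ - fderiv ℝ (f z) β₀ (β - β₀)‖ ≤ w z * ‖β - β₀‖ := by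
  have hβ₀ : β₀ ∈ U := mem_of_mem_nhds hU
  obtain ⟨r₀, hr₀, hr₀U⟩ := Metric.mem_nhds_iff.1 hU
  obtain ⟨S, hSc, hSd⟩ := TopologicalSpace.exists_countable_dense (EuclideanSpace ℝ (Fin p))
  let B : ℕ → Set (EuclideanSpace ℝ (Fin p)) := fun n => Metric.ball β₀ (r₀ / ((n : ℝ) + 1))
  have hrn : ∀ n : ℕ, 0 < r₀ / ((n : ℝ) + 1) := fun n => by positivity
  have hBU : ∀ n, B n ⊆ U := fun n => (Metric.ball_subset_ball
    (div_le_self hr₀.le (by linarith [Nat.cast_nonneg (α := ℝ) n]))).trans hr₀U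
  let e : 𝒵 → EuclideanSpace ℝ (Fin p) → ℝ := fun z β =>
    ‖f z β - f z β₀ - fderiv ℝ (f z) β₀ (β - β₀)‖
  let W : ℕ → 𝒵 → ℝ≥0∞ := fun n z =>
    ⨆ β ∈ B n ∩ S, ENNReal.ofReal (e z β / ‖β - β₀‖)
  have hdf : AEStronglyMeasurable (fun z => fderiv ℝ (f z) β₀) (P.map X) :=
    aestronglyMeasurable_fderiv hU hf (hd.mono fun z hz => hz β₀ hβ₀)
  have hWm : ∀ n, AEMeasurable (W n) (P.map X) := fun n => by
    refine AEMeasurable.biSup _ (hSc.mono Set.inter_subset_right) fun β hβ => ?_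
    have h1 : AEStronglyMeasurable
        (fun z => f z β - f z β₀ - fderiv ℝ (f z) β₀ (β - β₀)) (P.map X) :=
      ((hf β (hBU n hβ.1)).sub (hf β₀ hβ₀)).sub (hdf.apply_continuousLinearMap _)
    exact (h1.norm.aemeasurable.div_const _).ennreal_ofReal
  have hd' : ∀ᵐ ω ∂P, ∀ β ∈ U, DifferentiableAt ℝ (f (X ω)) β := ae_of_ae_map hX.aemeasurable hd
  have hlim : Tendsto (fun n => ∫⁻ ω, W n (X ω) ∂P) atTop (𝓝 (∫⁻ _, 0 ∂P)) := by
    refine tendsto_lintegral_of_dominated_convergence' (fun ω => ENNReal.ofReal (2 * M ω))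
      (fun n => (hWm n).comp_measurable hX) (fun n => ?_) ?_ ?_
    · filter_upwards [hbound, hd'] with ω hω hdω
      refine iSup₂_le fun β hβ => ENNReal.ofReal_le_ofReal ?_
      have hM0 : 0 ≤ M ω := (norm_nonneg _).trans (hω β₀ hβ₀)
      refine div_le_of_le_mul₀ (norm_nonneg _) (by positivity) ?_
      refine (convex_ball β₀ (r₀ / ((n : ℝ) + 1))).norm_image_sub_le_of_norm_fderiv_le'
        (fun x hx => hdω x (hBU n hx)) (fun x hx => ?_) (Metric.mem_ball_self (hrn n)) hβ.1
      refine (norm_sub_le _ _).trans ?_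
      linarith [hω x (hBU n hx), hω β₀ hβ₀]
    · exact (hM.const_mul 2).lintegral_lt_top.ne
    · filter_upwards [hd'] with ω hdω
      refine ENNReal.tendsto_nhds_zero.2 fun ε hε => ?_
      obtain ⟨c, hc0, hcε⟩ := ENNReal.lt_iff_exists_nnreal_btwn.1 hε
      have hc0' : (0 : ℝ) < c := by exact_mod_cast hc0
      have hder := (hdω β₀ hβ₀).hasFDerivAt.isLittleO.bound hc0'
      obtain ⟨r, hr, hsub⟩ := Metric.eventually_nhds_iff_ball.1 hder
      have hn : ∀ᶠ n : ℕ in atTop, r₀ / ((n : ℝ) + 1) < r := by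
        have := tendsto_one_div_add_atTop_nhds_zero_nat.const_mul r₀
        rw [mul_zero] at this
        filter_upwards [this.eventually_lt_const hr] with n hn
        rwa [mul_one_div] at hn
      filter_upwards [hn] with n hn
      refine (iSup₂_le fun β hβ => ?_).trans hcε.le
      rw [← ENNReal.ofReal_coe_nnreal]
      refine ENNReal.ofReal_le_ofReal (div_le_of_le_mul₀ (norm_nonneg _) hc0'.le ?_)
      exact hsub β (Metric.ball_subset_ball hn.le hβ.1)
  rw [lintegral_zero] at hlim
  obtain ⟨n, hn⟩ := (hlim.eventually_lt_const (ENNReal.ofReal_pos.2 hη)).exists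
  rw [← lintegral_map' (hWm n) hX.aemeasurable] at hn
  have hWtop : ∫⁻ z, W n z ∂(P.map X) ≠ ∞ := (hn.trans ENNReal.ofReal_lt_top).ne
  have hWfin : ∀ᵐ z ∂(P.map X), W n z < ∞ := ae_lt_top' (hWm n) hWtop
  refine ⟨r₀ / ((n : ℝ) + 1), hrn n, fun z => (W n z).toReal,
    integrable_toReal_of_lintegral_ne_top (hWm n) hWtop, ?_, ?_⟩
  · rw [integral_toReal (hWm n) hWfin]
    exact ENNReal.toReal_lt_of_lt_ofReal hn
  · filter_upwards [hWfin, hd] with z hz hdz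
    have hS : ∀ β ∈ B n ∩ S, e z β ≤ (W n z).toReal * ‖β - β₀‖ := fun β hβ => by
      rcases eq_or_ne β β₀ with rfl | hne
      · simp [e]
      · have h1 : ENNReal.ofReal (e z β / ‖β - β₀‖) ≤ W n z :=
          le_iSup₂ (f := fun β (_ : β ∈ B n ∩ S) => ENNReal.ofReal (e z β / ‖β - β₀‖)) β hβ
        have h2 := (ENNReal.ofReal_le_iff_le_toReal hz.ne).1 h1
        rwa [div_le_iff₀ (norm_pos_iff.2 (sub_ne_zero.2 hne))] at h2
    -- extend from the countable dense set by continuity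
    intro β hβ
    have hcl : β ∈ closure (B n ∩ S) := hSd.open_subset_closure_inter Metric.isOpen_ball hβ
    have hne : (nhdsWithin β (B n ∩ S)).NeBot := mem_closure_iff_nhdsWithin_neBot.1 hcl
    have hfc : ContinuousAt (f z) β := (hdz β (hBU n hβ)).continuousAt
    have hec : ContinuousAt (e z) β := by
      have : ContinuousAt (fun β => f z β - f z β₀ - fderiv ℝ (f z) β₀ (β - β₀)) β := by
        fun_prop
      exact this.norm
    have hrc : ContinuousAt (fun β => (W n z).toReal * ‖β - β₀‖) β := by fun_prop
    refine le_of_tendsto_of_tendsto (b := 𝓝[B n ∩ S] β) (hec.tendsto.mono_left nhdsWithin_le_nhds)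
      (hrc.tendsto.mono_left nhdsWithin_le_nhds) ?_
    filter_upwards [self_mem_nhdsWithin] with β' hβ' using hS β' hβ'

end Derivative

/-! ### Linearization of the first-order condition -/

section Linearization

variable {Ω 𝒵 F : Type*} [MeasurableSpace Ω] [MeasurableSpace 𝒵] {P : Measure Ω}
  [NormedAddCommGroup F] [NormedSpace ℝ F] {Z : ℕ → Ω → 𝒵} {p : ℕ}
  {f : 𝒵 → EuclideanSpace ℝ (Fin p) → F} {U : Set (EuclideanSpace ℝ (Fin p))}
  {β₀ : EuclideanSpace ℝ (Fin p)} {M : Ω → ℝ}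

lemma integrable_fderiv_of_bound {X : Ω → 𝒵} (hX : Measurable X) (hU : U ∈ 𝓝 β₀)
    (hfm : ∀ β ∈ U, AEStronglyMeasurable (fun z => f z β) (P.map X))
    (hd : ∀ᵐ z ∂(P.map X), ∀ β ∈ U, DifferentiableAt ℝ (f z) β) (hM : Integrable M P)
    (hbound : ∀ᵐ ω ∂P, ∀ β ∈ U, ‖fderiv ℝ (f (X ω)) β‖ ≤ M ω) :
    Integrable (fun z => fderiv ℝ (f z) β₀) (P.map X) := by
  have hβ₀ : β₀ ∈ U := mem_of_mem_nhds hU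
  have hHm : AEStronglyMeasurable (fun z => fderiv ℝ (f z) β₀) (P.map X) :=
    aestronglyMeasurable_fderiv hU hfm (hd.mono fun z hz => hz β₀ hβ₀)
  rw [integrable_map_measure hHm hX.aemeasurable]
  refine hM.mono' (hHm.comp_measurable hX) ?_
  filter_upwards [hbound] with ω hω using hω β₀ hβ₀

/-- Linearization of the estimating equation `∑ f(Z_i, b_n) = 0` of a consistent estimator: the
averaged score at `β₀` plus the expected derivative applied to the estimation error is negligible
relative to the estimation error. -/
theorem withHighProb_linearization [CompleteSpace F] [IsProbabilityMeasure P]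
    (hind : Pairwise fun i j => IndepFun (Z i) (Z j) P) (hZ : ∀ i, Measurable (Z i))
    (hid : ∀ i, IdentDistrib (Z i) (Z 0) P P) (hU : U ∈ 𝓝 β₀)
    (hfm : ∀ β ∈ U, AEStronglyMeasurable (fun z => f z β) (P.map (Z 0)))
    (hd : ∀ᵐ z ∂(P.map (Z 0)), ∀ β ∈ U, DifferentiableAt ℝ (f z) β) (hM : Integrable M P)
    (hbound : ∀ᵐ ω ∂P, ∀ β ∈ U, ‖fderiv ℝ (f (Z 0 ω)) β‖ ≤ M ω)
    {H : EuclideanSpace ℝ (Fin p) →L[ℝ] F}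
    (hH : ∀ v, ∫ z, fderiv ℝ (f z) β₀ v ∂(P.map (Z 0)) = H v)
    {b : ℕ → Ω → EuclideanSpace ℝ (Fin p)}
    (hroot : WithHighProb P fun n ω => ∑ i ∈ Finset.range n, f (Z i ω) (b n ω) = 0)
    (hcons : ∀ V ∈ 𝓝 β₀, WithHighProb P fun n ω => b n ω ∈ V) {η : ℝ} (hη : 0 < η) :
    WithHighProb P fun n ω =>
      ‖(n : ℝ)⁻¹ • ∑ i ∈ Finset.range n, f (Z i ω) β₀ + H (b n ω - β₀)‖ ≤ η * ‖b n ω - β₀‖ := by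
  have hHint := integrable_fderiv_of_bound (hZ 0) hU hfm hd hM hbound
  have hHeq : ∫ z, fderiv ℝ (f z) β₀ ∂(P.map (Z 0)) = H := by
    ext v
    rw [ContinuousLinearMap.integral_apply hHint, hH]
  obtain ⟨r, hr, w, hwi, hwη, hw⟩ :=
    exists_integrable_remainder (hZ 0) hU hfm hd hM hbound (half_pos hη)
  have hLLN := tendstoInMeasure_average hind hid hHint
  have hHS := withHighProb_norm_sub_lt hLLN (half_pos hη)
  rw [hHeq] at hHS
  have hwS := withHighProb_le_sum_of_integrable hind hid hwi.neg (c := -(η / 2)) (by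
    simp only [Pi.neg_apply, integral_neg]
    linarith)
  have hgood : ∀ᵐ ω ∂P, ∀ i,
      ∀ β ∈ Metric.ball β₀ r, ‖f (Z i ω) β - f (Z i ω) β₀ -
        fderiv ℝ (f (Z i ω)) β₀ (β - β₀)‖ ≤ w (Z i ω) * ‖β - β₀‖ := by
    rw [ae_all_iff]
    intro i
    rw [← (hid i).map_eq] at hw
    exact ae_of_ae_map (hZ i).aemeasurable hw
  refine (((hroot.and (hcons _ (Metric.ball_mem_nhds β₀ hr))).and hHS).and hwS).mono ?_
  filter_upwards [eventually_gt_atTop 0] with n hn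
  filter_upwards [hgood] with ω hω
  rintro ⟨⟨⟨h0, hbr⟩, hHω⟩, hwω⟩
  have hn' : (0 : ℝ) < n := by exact_mod_cast hn
  set d := b n ω - β₀ with hd
  have hkey : (n : ℝ)⁻¹ • ∑ i ∈ Finset.range n, f (Z i ω) β₀ + H d =
      -((n : ℝ)⁻¹ • ∑ i ∈ Finset.range n, (f (Z i ω) (b n ω) -
          f (Z i ω) β₀ - fderiv ℝ (f (Z i ω)) β₀ d)) -
        ((n : ℝ)⁻¹ • ∑ i ∈ Finset.range n, fderiv ℝ (f (Z i ω)) β₀ - H) d := by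
    simp only [Finset.sum_sub_distrib, h0, smul_sub, sub_apply,
      smul_apply, sum_apply, smul_zero]
    abel
  rw [hkey]
  refine (norm_sub_le _ _).trans ?_
  rw [norm_neg]
  have h1 : ‖(n : ℝ)⁻¹ • ∑ i ∈ Finset.range n, (f (Z i ω) (b n ω) -
      f (Z i ω) β₀ - fderiv ℝ (f (Z i ω)) β₀ d)‖ ≤ η / 2 * ‖d‖ := by
    rw [norm_smul, norm_inv, Real.norm_of_nonneg hn'.le, inv_mul_le_iff₀ hn']
    refine (norm_sum_le_of_le _ fun i _ => hω i _ hbr).trans ?_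
    rw [← Finset.sum_mul]
    simp only [Pi.neg_apply, Finset.sum_neg_distrib] at hwω
    have : ∑ i ∈ Finset.range n, w (Z i ω) ≤ n * (η / 2) := by linarith
    calc _ ≤ n * (η / 2) * ‖d‖ := mul_le_mul_of_nonneg_right this (norm_nonneg _)
      _ = _ := by ring
  have h2 := (ContinuousLinearMap.le_opNorm
    ((n : ℝ)⁻¹ • ∑ i ∈ Finset.range n, fderiv ℝ (f (Z i ω)) β₀ - H) d).trans
    (mul_le_mul_of_nonneg_right hHω.le (norm_nonneg d))
  linarith

/-- Slutsky's theorem for a relative error: if `T n` converges in distribution and `u n` differs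
from `T n` by a quantity negligible relative to `T n`, then `u n` has the same limit. -/
theorem tendstoInDistribution_of_relative_error [IsProbabilityMeasure P] {E : Type*}
    [NormedAddCommGroup E] [NormedSpace ℝ E] [MeasurableSpace E] [BorelSpace E] [SecondCountableTopology E]
    {ν : Measure E} [IsProbabilityMeasure ν] {T u : ℕ → Ω → E}
    (hT : TendstoInDistribution T atTop id (fun _ => P) ν) (hu : ∀ n, AEMeasurable (u n) P)
    (h : ∀ η > 0, WithHighProb P fun n ω => ‖u n ω - T n ω‖ ≤ η * ‖T n ω‖) :
    TendstoInDistribution u atTop id (fun _ => P) ν := by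
  have hTm := hT.forall_aemeasurable
  let e : ℕ → Ω → E := fun n ω => ‖T n ω‖⁻¹ • (u n ω - T n ω)
  have he : TendstoInMeasure P e atTop (fun _ => 0) := by
    refine tendstoInMeasure_of_withHighProb fun δ hδ => (h (δ / 2) (half_pos hδ)).mono
      (Eventually.of_forall fun n => Eventually.of_forall fun ω hω => ?_)
    rw [sub_zero, norm_smul, norm_inv, norm_norm]
    rcases eq_or_ne (T n ω) 0 with h0 | h0
    · simpa [h0] using hδ
    · rw [inv_mul_lt_iff₀ (norm_pos_iff.2 h0)]
      have := norm_pos_iff.2 h0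
      nlinarith
  have hem : ∀ n, AEMeasurable (e n) P := fun n =>
    (hTm n).norm.inv.smul ((hu n).sub (hTm n))
  have hlim : TendstoInDistribution (fun n ω => T n ω + ‖T n ω‖ • e n ω) atTop id
      (fun _ => P) ν := by
    have := hT.continuous_comp_prodMk_of_tendstoInMeasure_const
      (g := fun x : E × E => x.1 + ‖x.1‖ • x.2) (by fun_prop) he hem
    simp only [id, smul_zero, add_zero] at this
    exact this
  refine tendstoInDistribution_of_tendstoInMeasure_sub (X := fun n ω => T n ω + ‖T n ω‖ • e n ω)
    u id hlim ?_ hu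
  refine tendstoInMeasure_of_withHighProb fun δ hδ => (h 1 one_pos).mono
    (Eventually.of_forall fun n => Eventually.of_forall fun ω hω => ?_)
  rcases eq_or_ne (T n ω) 0 with h0 | h0
  · rw [h0] at hω
    have : u n ω = 0 := by simpa using hω
    simpa [h0, this] using hδ
  · simp [e, smul_smul, mul_inv_cancel₀ (norm_ne_zero_iff.2 h0), hδ]

end Linearization

/-! ### Derivatives of the squared residual -/

section Calculus

variable {p m : ℕ} {h : EuclideanSpace ℝ (Fin p) → EuclideanSpace ℝ (Fin m)}
  {y : EuclideanSpace ℝ (Fin m)} {U : Set (EuclideanSpace ℝ (Fin p))}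
  {β : EuclideanSpace ℝ (Fin p)}

lemma fderiv_sq_norm_sub_apply (hh : DifferentiableAt ℝ h β) (v : EuclideanSpace ℝ (Fin p)) :
    fderiv ℝ (fun b => ‖y - h b‖ ^ 2) β v = -2 * inner ℝ (y - h β) (fderiv ℝ h β v) := by
  have := ((hasFDerivAt_const y β).sub hh.hasFDerivAt).norm_sq
  have h2 := this.fderiv
  simp only [Pi.sub_apply] at h2
  rw [h2]
  simp only [nsmul_eq_mul, Nat.cast_ofNat, ContinuousLinearMap.comp_apply, zero_sub, smul_apply,
    neg_apply, innerSL_apply_apply, inner_neg_right]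
  ring

lemma contDiffOn_sq_norm_sub (hh : ContDiffOn ℝ 2 h U) :
    ContDiffOn ℝ 2 (fun b => ‖y - h b‖ ^ 2) U :=
  (contDiffOn_const.sub hh).norm_sq ℝ

lemma fderiv_fderiv_sq_norm_sub_apply (hU : IsOpen U) (hβ : β ∈ U) (hh : ContDiffOn ℝ 2 h U)
    (u v : EuclideanSpace ℝ (Fin p)) :
    fderiv ℝ (fderiv ℝ fun b => ‖y - h b‖ ^ 2) β u v =
      2 * inner ℝ (fderiv ℝ h β u) (fderiv ℝ h β v) -
        2 * inner ℝ (y - h β) (fderiv ℝ (fderiv ℝ h) β u v) := by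
  have hUn := hU.mem_nhds hβ
  have hd : ∀ b ∈ U, DifferentiableAt ℝ h b := fun b hb =>
    (hh.contDiffAt (hU.mem_nhds hb)).differentiableAt (by norm_num)
  have hd2 : DifferentiableAt ℝ (fderiv ℝ h) β :=
    ((hh.contDiffAt hUn).fderiv_right (m := 1) (by norm_num)).differentiableAt (by norm_num)
  have hq2 : DifferentiableAt ℝ (fderiv ℝ fun b => ‖y - h b‖ ^ 2) β :=
    (((contDiffOn_sq_norm_sub hh).contDiffAt hUn).fderiv_right (m := 1)
      (by norm_num)).differentiableAt (by norm_num)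
  have h1 : HasFDerivAt (fun b => fderiv ℝ (fun b => ‖y - h b‖ ^ 2) b v)
      ((fderiv ℝ (fderiv ℝ fun b => ‖y - h b‖ ^ 2) β).flip v) β := by
    simpa using hq2.hasFDerivAt.clm_apply (hasFDerivAt_const v β)
  have h2 : HasFDerivAt (fun b => fderiv ℝ h b v) ((fderiv ℝ (fderiv ℝ h) β).flip v) β := by
    simpa using hd2.hasFDerivAt.clm_apply (hasFDerivAt_const v β)
  have h3 := (((hasFDerivAt_const y β).sub (hd β hβ).hasFDerivAt).inner ℝ h2).const_mul (-2)
  have heq : (fun b => fderiv ℝ (fun b => ‖y - h b‖ ^ 2) b v) =ᶠ[𝓝 β]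
      fun b => -2 * inner ℝ (y - h b) (fderiv ℝ h b v) := by
    filter_upwards [hUn] with b hb using fderiv_sq_norm_sub_apply (hd b hb) v
  have h4 := (h1.congr_of_eventuallyEq heq.symm).unique h3
  have h5 := congrArg (fun L => L u) h4
  simp only [ContinuousLinearMap.flip_apply] at h5
  rw [h5]
  simp
  ring

end Calculus

lemma fderiv_apply_eq_jacobian {𝒳 : Type*} {p m : ℕ}
    (g : 𝒳 → EuclideanSpace ℝ (Fin p) → EuclideanSpace ℝ (Fin m)) (x : 𝒳)
    (β v : EuclideanSpace ℝ (Fin p)) (i : Fin m) :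
    fderiv ℝ (g x) β v i = ∑ j, jacobian g x β i j * v j := by
  conv_lhs => rw [clm_eq_sum_smulRight (fderiv ℝ (g x) β)]
  simp [jacobian, mul_comm]

lemma inner_fderiv_eq_dotProduct {𝒳 : Type*} {p m : ℕ}
    (g : 𝒳 → EuclideanSpace ℝ (Fin p) → EuclideanSpace ℝ (Fin m)) (x : 𝒳)
    (β v : EuclideanSpace ℝ (Fin p)) (e : EuclideanSpace ℝ (Fin m)) :
    inner ℝ e (fderiv ℝ (g x) β v) =
      inner ℝ (WithLp.toLp 2 ((jacobian g x β)ᵀ *ᵥ (fun k => e k)) : EuclideanSpace ℝ (Fin p))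
        v := by
  simp only [PiLp.inner_apply, RCLike.inner_apply, conj_trivial, fderiv_apply_eq_jacobian,
    Matrix.mulVec, dotProduct, Matrix.transpose_apply, Finset.sum_mul, Finset.mul_sum]
  rw [Finset.sum_comm]
  exact Finset.sum_congr rfl fun _ _ => Finset.sum_congr rfl fun _ _ => by ring

/-! ### Conditional moments -/

section Conditional

variable {Ω 𝒳 : Type*} [MeasurableSpace Ω] [MeasurableSpace 𝒳] {P : Measure Ω}
  [IsProbabilityMeasure P]

omit [IsProbabilityMeasure P] in
lemma aestronglyMeasurable_comap_comp {F : Type*} [TopologicalSpace F] {X : Ω → 𝒳}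
    (hX : Measurable X) {h : 𝒳 → F} (hh : AEStronglyMeasurable h (P.map X)) :
    AEStronglyMeasurable[MeasurableSpace.comap X inferInstance] (fun ω => h (X ω)) P := by
  refine ⟨fun ω => hh.mk h (X ω), ?_, ae_of_ae_map hX.aemeasurable hh.ae_eq_mk⟩
  exact hh.stronglyMeasurable_mk.comp_measurable (comap_measurable X)

/-- A conditionally centred vector is orthogonal in mean to every function of the conditioning
variable, as soon as the inner product is integrable (the function itself need not be). -/
lemma integral_inner_eq_zero_of_condExp {m : ℕ} {X : Ω → 𝒳} (hX : Measurable X)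
    {e : Ω → EuclideanSpace ℝ (Fin m)} (he : Integrable e P)
    (hmean : P[e | MeasurableSpace.comap X inferInstance] =ᵐ[P] 0)
    {h : 𝒳 → EuclideanSpace ℝ (Fin m)} (hh : AEStronglyMeasurable h (P.map X))
    (hint : Integrable (fun ω => inner ℝ (e ω) (h (X ω))) P) :
    ∫ ω, inner ℝ (e ω) (h (X ω)) ∂P = 0 := by
  have hm : MeasurableSpace.comap X inferInstance ≤ (inferInstance : MeasurableSpace Ω) :=
    hX.comap_le
  simp_rw [fun ω => real_inner_comm (h (X ω)) (e ω)] at hint ⊢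
  have h1 : P[fun ω => inner ℝ (h (X ω)) (e ω) | MeasurableSpace.comap X inferInstance] =ᵐ[P]
      fun ω => inner ℝ (h (X ω)) (P[e | MeasurableSpace.comap X inferInstance] ω) :=
    condExp_bilin_of_aestronglyMeasurable_left (innerSL ℝ)
      (aestronglyMeasurable_comap_comp hX hh) hint he
  rw [← integral_condExp hm]
  refine integral_eq_zero_of_ae ?_
  filter_upwards [h1, hmean] with ω hω hω2
  rw [hω, hω2]
  simp

omit [IsProbabilityMeasure P] in
/-- The conditional expectation of `f(Z)` given `X = π(Z)` is a function of `Z` that depends on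
the law of `Z` only. -/
lemma condExp_comp_ae_eq {𝒵 : Type*} [MeasurableSpace 𝒵] [IsFiniteMeasure P] {Z : Ω → 𝒵}
    (hZ : Measurable Z) {π : 𝒵 → 𝒳} (hπ : Measurable π) {f : 𝒵 → ℝ}
    (hf : Integrable f (P.map Z)) :
    (fun ω => ((P.map Z)[f | MeasurableSpace.comap π inferInstance]) (Z ω)) =ᵐ[P]
      P[fun ω => f (Z ω) | MeasurableSpace.comap (fun ω => π (Z ω)) inferInstance] := by
  have hc : Integrable ((P.map Z)[f | MeasurableSpace.comap π inferInstance]) (P.map Z) :=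
    integrable_condExp
  have hcΩ : Integrable (fun ω => ((P.map Z)[f | MeasurableSpace.comap π inferInstance]) (Z ω)) P :=
    (integrable_map_measure hc.1 hZ.aemeasurable).1 hc
  have hfΩ : Integrable (fun ω => f (Z ω)) P := (integrable_map_measure hf.1 hZ.aemeasurable).1 hf
  have hm : MeasurableSpace.comap (fun ω => π (Z ω)) inferInstance ≤
      (inferInstance : MeasurableSpace Ω) := (hπ.comp hZ).comap_le
  refine ae_eq_condExp_of_forall_setIntegral_eq hm hfΩ (fun s _ _ => hcΩ.integrableOn) ?_ ?_
  · rintro s ⟨B, hB, rfl⟩ -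
    have hB' : MeasurableSet (π ⁻¹' B) := hπ hB
    have hpre : (fun ω => π (Z ω)) ⁻¹' B = Z ⁻¹' (π ⁻¹' B) := rfl
    rw [hpre, ← setIntegral_map hB' hc.1 hZ.aemeasurable,
      ← setIntegral_map hB' hf.1 hZ.aemeasurable]
    exact setIntegral_condExp hπ.comap_le hf ⟨B, hB, rfl⟩
  · refine StronglyMeasurable.aestronglyMeasurable ?_
    refine StronglyMeasurable.comp_measurable
      (stronglyMeasurable_condExp (m := MeasurableSpace.comap π inferInstance)) ?_
    rw [measurable_iff_comap_le, MeasurableSpace.comap_comp]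
    rfl

/-- The conditional sandwich `G' Var(e | X) G` with `G = A(X)` is the conditional second moment of
the score `G'e`. The matrix `G` need not be integrable, as long as the score is square
integrable. -/
lemma transpose_mul_condCov_mul_ae_eq {p m : ℕ} {X : Ω → 𝒳} (hX : Measurable X)
    {e : Ω → EuclideanSpace ℝ (Fin m)} (he : MemLp e 2 P)
    (hmean : P[e | MeasurableSpace.comap X inferInstance] =ᵐ[P] 0)
    {A : 𝒳 → Matrix (Fin m) (Fin p) ℝ}
    (hA : ∀ a j, AEStronglyMeasurable (fun x => A x a j) (P.map X))
    (hscore : ∀ j, MemLp (fun ω => ((A (X ω))ᵀ *ᵥ (fun a => e ω a)) j) 2 P) (j k : Fin p) :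
    (fun ω => ((A (X ω))ᵀ * condCov P e X ω * A (X ω)) j k) =ᵐ[P]
      P[fun ω => ((A (X ω))ᵀ *ᵥ (fun a => e ω a)) j * ((A (X ω))ᵀ *ᵥ (fun a => e ω a)) k |
        MeasurableSpace.comap X inferInstance] := by
  have hei : Integrable e P := he.integrable (by norm_num)
  have hea : ∀ a, MemLp (fun ω => e ω a) 2 P := fun a =>
    (EuclideanSpace.proj a : EuclideanSpace ℝ (Fin m) →L[ℝ] ℝ).comp_memLp' he
  have hcent : ∀ a, P[fun ω => e ω a | MeasurableSpace.comap X inferInstance] =ᵐ[P] 0 := fun a => by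
    have := (EuclideanSpace.proj a : EuclideanSpace ℝ (Fin m) →L[ℝ] ℝ).comp_condExp_comm
      (m := MeasurableSpace.comap X inferInstance) hei
    filter_upwards [this, hmean] with ω h1 h2
    have h3 : P[fun ω => e ω a | MeasurableSpace.comap X inferInstance] ω =
      P[(EuclideanSpace.proj a : EuclideanSpace ℝ (Fin m) →L[ℝ] ℝ) ∘ e |
        MeasurableSpace.comap X inferInstance] ω := rfl
    rw [h3, ← h1]
    simp [h2]
  -- vectorized outer products `ee'` and `A_j A_k'`
  let E2 : Ω → EuclideanSpace ℝ (Fin m × Fin m) := fun ω => WithLp.toLp 2 fun c => e ω c.1 * e ω c.2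
  let W : 𝒳 → EuclideanSpace ℝ (Fin m × Fin m) := fun x =>
    WithLp.toLp 2 fun c => A x c.1 j * A x c.2 k
  have hE2 : Integrable E2 P := by
    refine MemLp.integrable le_rfl (MemLp.of_eval_piLp fun c => ?_)
    exact memLp_one_iff_integrable.2 ((hea c.1).integrable_mul (hea c.2))
  have hW : AEStronglyMeasurable W (P.map X) := by
    refine (PiLp.continuous_toLp 2 _).comp_aestronglyMeasurable
      (aemeasurable_pi_lambda _ fun c => ?_).aestronglyMeasurable
    exact ((hA c.1 j).mul (hA c.2 k)).aemeasurable
  have hinner : ∀ ω, inner ℝ (W (X ω)) (E2 ω) =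
      ((A (X ω))ᵀ *ᵥ (fun a => e ω a)) j * ((A (X ω))ᵀ *ᵥ (fun a => e ω a)) k := fun ω => by
    simp only [PiLp.inner_apply, RCLike.inner_apply, conj_trivial, W, E2, Matrix.mulVec,
      dotProduct, Matrix.transpose_apply, Finset.sum_mul_sum, Fintype.sum_prod_type]
    exact Finset.sum_congr rfl fun _ _ => Finset.sum_congr rfl fun _ _ => by ring
  have h1 : P[fun ω => inner ℝ (W (X ω)) (E2 ω) | MeasurableSpace.comap X inferInstance] =ᵐ[P]
      fun ω => inner ℝ (W (X ω)) (P[E2 | MeasurableSpace.comap X inferInstance] ω) :=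
    condExp_bilin_of_aestronglyMeasurable_left (innerSL ℝ)
      (aestronglyMeasurable_comap_comp hX hW)
      (((hscore j).integrable_mul (hscore k)).congr
        (Eventually.of_forall fun ω => (hinner ω).symm)) hE2
  simp only [hinner] at h1
  refine EventuallyEq.trans ?_ h1.symm
  have hcov : ∀ c : Fin m × Fin m, (fun ω => condCov P e X ω c.1 c.2) =ᵐ[P]
      fun ω => (P[E2 | MeasurableSpace.comap X inferInstance] ω) c := fun c => by
    have h2 := (EuclideanSpace.proj c : EuclideanSpace ℝ (Fin m × Fin m) →L[ℝ] ℝ).comp_condExp_comm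
      (m := MeasurableSpace.comap X inferInstance) hE2
    refine EventuallyEq.trans ?_ h2.symm
    refine condExp_congr_ae ?_
    filter_upwards [hcent c.1, hcent c.2] with ω hω1 hω2
    rw [hω1, hω2]
    simp [E2]
  filter_upwards [ae_all_iff.2 hcov] with ω hω
  simp only [PiLp.inner_apply, RCLike.inner_apply, conj_trivial, W, Fintype.sum_prod_type, ← hω,
    Matrix.mul_apply, Matrix.transpose_apply, Finset.sum_mul]
  rw [Finset.sum_comm]
  exact Finset.sum_congr rfl fun _ _ => Finset.sum_congr rfl fun _ _ => by ring

end Conditional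

/-- If the averages of the Gram matrices `A(X_i)'A(X_i)` of i.i.d. data converge in probability,
then the Gram matrix is integrable and the limit is its expectation. -/
lemma integrable_gram_of_isPlimAverage {Ω 𝒳 : Type*} [MeasurableSpace Ω] [MeasurableSpace 𝒳]
    {P : Measure Ω} [IsProbabilityMeasure P] {p m : ℕ} {X : ℕ → Ω → 𝒳}
    (hind : Pairwise fun i j => IndepFun (X i) (X j) P)
    (hid : ∀ i, IdentDistrib (X i) (X 0) P P) {A : 𝒳 → Matrix (Fin m) (Fin p) ℝ}
    (hA : ∀ a j, AEStronglyMeasurable (fun x => A x a j) (P.map (X 0)))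
    {H : Matrix (Fin p) (Fin p) ℝ}
    (hH : IsPlimAverage P (fun i ω => (A (X i ω))ᵀ * A (X i ω)) H) (j k : Fin p) :
    Integrable (fun x => ((A x)ᵀ * A x) j k) (P.map (X 0)) ∧
      H j k = ∫ x, ((A x)ᵀ * A x) j k ∂(P.map (X 0)) := by
  have hgram : ∀ x j k, ((A x)ᵀ * A x) j k = ∑ a, A x a j * A x a k := fun x j k => by
    simp [Matrix.mul_apply]
  have hm : ∀ j k, AEStronglyMeasurable (fun x => ((A x)ᵀ * A x) j k) (P.map (X 0)) := fun j k => by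
    simp only [hgram]
    exact Finset.aestronglyMeasurable_fun_sum _ fun a _ => (hA a j).mul (hA a k)
  have hdiag : ∀ j, Integrable (fun x => ((A x)ᵀ * A x) j j) (P.map (X 0)) := fun j => by
    refine integrable_of_tendstoInMeasure_average hind hid (hm j j) (fun x => ?_) (hH j j)
    rw [hgram]
    exact Finset.sum_nonneg fun a _ => mul_self_nonneg _
  have hint : Integrable (fun x => ((A x)ᵀ * A x) j k) (P.map (X 0)) := by
    refine ((hdiag j).add (hdiag k)).mono' (hm j k) (Eventually.of_forall fun x => ?_)
    simp only [Pi.add_apply, hgram, ← Finset.sum_add_distrib]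
    refine (Finset.abs_sum_le_sum_abs _ _).trans (Finset.sum_le_sum fun a _ => ?_)
    rw [abs_mul]
    nlinarith [sq_nonneg (|A x a j| - |A x a k|), abs_mul_abs_self (A x a j),
      abs_mul_abs_self (A x a k), mul_self_nonneg (A x a j), mul_self_nonneg (A x a k)]
  refine ⟨hint, ?_⟩
  have h1 := tendstoInMeasure_average hind hid hint
  have h2 := tendstoInMeasure_ae_unique (hH j k) h1
  exact h2.exists.choose_spec

/-! ### Separation of the expected criterion -/

section Separation

variable {Ω : Type*} [MeasurableSpace Ω] {P : Measure Ω}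

lemma lintegral_enorm_sq_eq_ofReal {F : Type*} [NormedAddCommGroup F] {f : Ω → F}
    (hf : MemLp f 2 P) : ∫⁻ ω, ‖f ω‖ₑ ^ 2 ∂P = ENNReal.ofReal (∫ ω, ‖f ω‖ ^ 2 ∂P) := by
  rw [ofReal_integral_eq_lintegral_ofReal ((memLp_two_iff_integrable_sq_norm hf.1).1 hf)
    (Eventually.of_forall fun _ => sq_nonneg _)]
  refine lintegral_congr fun ω => ?_
  rw [ENNReal.ofReal_pow (norm_nonneg _), ofReal_norm]

lemma memLp_two_of_lintegral_enorm_sq_ne_top {F : Type*} [NormedAddCommGroup F] {f : Ω → F}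
    (hf : AEStronglyMeasurable f P) (h : ∫⁻ ω, ‖f ω‖ₑ ^ 2 ∂P ≠ ∞) : MemLp f 2 P := by
  rw [memLp_two_iff_integrable_sq_norm hf]
  refine ⟨hf.norm.pow 2, ?_⟩
  rw [hasFiniteIntegral_iff_ofReal (Eventually.of_forall fun _ => sq_nonneg _)]
  refine lt_of_eq_of_lt (lintegral_congr fun ω => ?_) (lt_top_iff_ne_top.2 h)
  rw [ENNReal.ofReal_pow (norm_nonneg _), ofReal_norm]

/-- Pythagoras for conditionally centred errors: subtracting a function of the regressors that
does not vanish almost surely strictly increases the mean squared norm. -/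
lemma lintegral_enorm_sq_lt_of_condExp {𝒳 : Type*} [MeasurableSpace 𝒳] [IsProbabilityMeasure P]
    {m : ℕ} {X : Ω → 𝒳} (hX : Measurable X) {e : Ω → EuclideanSpace ℝ (Fin m)} (he : MemLp e 2 P)
    (hmean : P[e | MeasurableSpace.comap X inferInstance] =ᵐ[P] 0)
    {h : 𝒳 → EuclideanSpace ℝ (Fin m)} (hh : Measurable h)
    (hne : ∫⁻ ω, ‖h (X ω)‖ₑ ^ 2 ∂P ≠ 0) :
    ∫⁻ ω, ‖e ω‖ₑ ^ 2 ∂P < ∫⁻ ω, ‖e ω - h (X ω)‖ₑ ^ 2 ∂P := by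
  have hhX : AEStronglyMeasurable (fun ω => h (X ω)) P := (hh.comp hX).aestronglyMeasurable
  by_cases htop : ∫⁻ ω, ‖e ω - h (X ω)‖ₑ ^ 2 ∂P = ∞
  · rw [htop, lintegral_enorm_sq_eq_ofReal he]
    exact ENNReal.ofReal_lt_top
  have hd : MemLp (fun ω => e ω - h (X ω)) 2 P :=
    memLp_two_of_lintegral_enorm_sq_ne_top (he.1.sub hhX) htop
  have hL2 : MemLp (fun ω => h (X ω)) 2 P := by
    have := he.sub hd
    refine (memLp_congr_ae (Eventually.of_forall fun ω => ?_)).1 this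
    simp
  rw [lintegral_enorm_sq_eq_ofReal he, lintegral_enorm_sq_eq_ofReal hd]
  rw [lintegral_enorm_sq_eq_ofReal hL2, Ne, ENNReal.ofReal_eq_zero, not_le] at hne
  have hi1 := (memLp_two_iff_integrable_sq_norm he.1).1 he
  have hi2 := (memLp_two_iff_integrable_sq_norm hL2.1).1 hL2
  have hcross : Integrable (fun ω => inner ℝ (e ω) (h (X ω))) P := by
    refine (hi1.add hi2).mono' (he.1.inner hhX) (Eventually.of_forall fun ω => ?_)
    refine (norm_inner_le_norm _ _).trans ?_
    simp only [Pi.add_apply]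
    nlinarith [sq_nonneg (‖e ω‖ - ‖h (X ω)‖), sq_nonneg ‖e ω‖, sq_nonneg ‖h (X ω)‖]
  have h0 := integral_inner_eq_zero_of_condExp hX (he.integrable (by norm_num)) hmean
    hh.aestronglyMeasurable hcross
  have hsum : ∫ ω, ‖e ω - h (X ω)‖ ^ 2 ∂P = ∫ ω, ‖e ω‖ ^ 2 ∂P + ∫ ω, ‖h (X ω)‖ ^ 2 ∂P := by
    have : ∀ ω, ‖e ω - h (X ω)‖ ^ 2 =
        ‖e ω‖ ^ 2 - 2 * inner ℝ (e ω) (h (X ω)) + ‖h (X ω)‖ ^ 2 := fun ω =>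
      norm_sub_sq_real _ _
    simp_rw [this]
    have hi3 : Integrable (fun ω => ‖e ω‖ ^ 2 - 2 * inner ℝ (e ω) (h (X ω))) P :=
      hi1.sub (hcross.const_mul 2)
    rw [integral_add hi3 hi2, integral_sub hi1 (hcross.const_mul 2),
      integral_const_mul, h0]
    ring
  rw [hsum, ENNReal.ofReal_lt_ofReal_iff_of_nonneg (integral_nonneg fun _ => sq_nonneg _)]
  linarith

end Separation

/-! ### Asymptotic normality from a linearized estimating equation -/

section Normality

variable {Ω : Type*} [MeasurableSpace Ω] {P : Measure Ω} [IsProbabilityMeasure P] {p : ℕ}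

omit [IsProbabilityMeasure P] in
lemma secondMoment_toEuclideanCLM (A : Matrix (Fin p) (Fin p) ℝ)
    {s : Ω → EuclideanSpace ℝ (Fin p)} (hs : MemLp s 2 P) :
    (Matrix.of fun j k => ∫ ω, (Matrix.toEuclideanCLM (𝕜 := ℝ) A (s ω)) j *
      (Matrix.toEuclideanCLM (𝕜 := ℝ) A (s ω)) k ∂P) =
      A * (Matrix.of fun j k => ∫ ω, s ω j * s ω k ∂P) * Aᵀ := by
  have hsj : ∀ j, MemLp (fun ω => s ω j) 2 P := fun j =>
    (EuclideanSpace.proj j : EuclideanSpace ℝ (Fin p) →L[ℝ] ℝ).comp_memLp' hs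
  have hint : ∀ j k, Integrable (fun ω => s ω j * s ω k) P := fun j k =>
    (hsj j).integrable_mul (hsj k)
  ext j k
  have : ∀ ω, (Matrix.toEuclideanCLM (𝕜 := ℝ) A (s ω)) j *
      (Matrix.toEuclideanCLM (𝕜 := ℝ) A (s ω)) k =
        ∑ c, ∑ a, A j a * A k c * (s ω a * s ω c) := fun ω => by
    simp only [Matrix.ofLp_toEuclideanCLM, Matrix.mulVec, dotProduct, Finset.sum_mul_sum]
    rw [Finset.sum_comm]
    exact Finset.sum_congr rfl fun _ _ => Finset.sum_congr rfl fun _ _ => by ring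
  simp only [Matrix.of_apply, this, Matrix.mul_apply, Matrix.transpose_apply]
  rw [integral_finsetSum _ fun c _ => integrable_finsetSum _ fun a _ => (hint a c).const_mul _]
  refine Finset.sum_congr rfl fun c _ => ?_
  rw [integral_finsetSum _ fun a _ => (hint a c).const_mul _, Finset.sum_mul]
  refine Finset.sum_congr rfl fun a _ => ?_
  rw [integral_const_mul]
  ring

/-- If `H (b_n - β₀)` equals an average of centred i.i.d. scores up to an error negligible relative
to `b_n - β₀`, then `√n (b_n - β₀)` is asymptotically normal with the sandwich covariance. The
rate `√n` need not be known beforehand. -/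
theorem asymptoticallyNormal_of_linearization {s : ℕ → Ω → EuclideanSpace ℝ (Fin p)}
    (hs : MemLp (s 0) 2 P) (h0 : ∫ ω, s 0 ω ∂P = 0) (hind : iIndepFun s P)
    (hid : ∀ i, IdentDistrib (s i) (s 0) P P) {H : Matrix (Fin p) (Fin p) ℝ} (hH : H.PosDef)
    {b : ℕ → Ω → EuclideanSpace ℝ (Fin p)} {β₀ : EuclideanSpace ℝ (Fin p)}
    (hb : ∀ n, AEMeasurable (b n) P)
    (hlin : ∀ η > 0, WithHighProb P fun n ω =>
      ‖Matrix.toEuclideanCLM (𝕜 := ℝ) H (b n ω - β₀) -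
        (n : ℝ)⁻¹ • ∑ i ∈ Finset.range n, s i ω‖ ≤ η * ‖b n ω - β₀‖) :
    AsymptoticallyNormal P b β₀
      (H⁻¹ * (Matrix.of fun j k => ∫ ω, s 0 ω j * s 0 ω k ∂P) * H⁻¹) := by
  set L : EuclideanSpace ℝ (Fin p) →L[ℝ] EuclideanSpace ℝ (Fin p) :=
    Matrix.toEuclideanCLM (𝕜 := ℝ) H⁻¹ with hL
  have hLH : ∀ v, L (Matrix.toEuclideanCLM (𝕜 := ℝ) H v) = v := fun v => by
    rw [hL, ← mul_apply_eq_comp, ← map_mul,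
      Matrix.nonsing_inv_mul _ ((Matrix.isUnit_iff_isUnit_det _).1 hH.isUnit), map_one]
    rfl
  have hsymm : (H⁻¹)ᵀ = H⁻¹ := by
    have := hH.isHermitian.inv.eq
    rwa [Matrix.conjTranspose_eq_transpose_of_trivial] at this
  have hLm : Measurable L := L.continuous.measurable
  have hLs : MemLp (fun ω => L (s 0 ω)) 2 P := L.comp_memLp' hs
  have hcov := secondMoment_toEuclideanCLM H⁻¹ hs
  rw [hsymm] at hcov
  rw [← hcov]
  refine ⟨posSemidef_secondMoment hLs, ?_⟩
  have hclt := tendstoInDistribution_inv_sqrt_smul_sum (X := fun i ω => L (s i ω)) hLs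
    (by rw [L.integral_comp_comm (hs.integrable (by norm_num)), h0, map_zero])
    (hind.comp (fun _ => L) fun _ => hLm) (fun i => (hid i).comp hLm)
  refine tendstoInDistribution_of_relative_error hclt
    (fun n => ((hb n).sub_const β₀).const_smul (√(n : ℝ))) fun η hη => ?_
  -- a bound `κ` on the relative error of `u` with respect to itself gives `2κ` relative to `T`
  set κ := min (1 / 2) (η / 2) with hκ
  have hκ0 : 0 < κ := lt_min (by norm_num) (half_pos hη)
  have hL1 : 0 < ‖L‖ + 1 := by positivity
  refine (hlin (κ / (‖L‖ + 1)) (div_pos hκ0 hL1)).mono ?_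
  filter_upwards [eventually_gt_atTop 0] with n hn
  refine Eventually.of_forall fun ω hω => ?_
  have hn' : (0 : ℝ) < n := by exact_mod_cast hn
  set d := b n ω - β₀
  set t := (n : ℝ)⁻¹ • ∑ i ∈ Finset.range n, s i ω
  have hd : ‖d - L t‖ ≤ κ * ‖d‖ := by
    have : d - L t = L (Matrix.toEuclideanCLM (𝕜 := ℝ) H d - t) := by rw [map_sub, hLH]
    rw [this]
    calc _ ≤ ‖L‖ * (κ / (‖L‖ + 1) * ‖d‖) := (L.le_opNorm _).trans
            (mul_le_mul_of_nonneg_left hω (norm_nonneg _))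
      _ = (‖L‖ / (‖L‖ + 1)) * (κ * ‖d‖) := by ring
      _ ≤ 1 * (κ * ‖d‖) := by
          refine mul_le_mul_of_nonneg_right ?_ (by positivity)
          exact (div_le_one hL1).2 (by linarith)
      _ = κ * ‖d‖ := one_mul _
  have hsq : √(n : ℝ) * (n : ℝ)⁻¹ = (√(n : ℝ))⁻¹ := by
    rw [← div_eq_mul_inv, Real.sqrt_div_self]
  have hT : (√(n : ℝ))⁻¹ • ∑ i ∈ Finset.range n, L (s i ω) = √(n : ℝ) • L t := by
    rw [map_smul, map_sum, smul_smul, hsq]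
  rw [hT, ← smul_sub, norm_smul, norm_smul, mul_left_comm]
  refine mul_le_mul_of_nonneg_left ?_ (norm_nonneg _)
  have h1 : ‖d‖ ≤ ‖L t‖ + ‖d - L t‖ := by
    have := norm_add_le (L t) (d - L t)
    rwa [add_sub_cancel] at this
  have hκ1 : κ ≤ 1 / 2 := min_le_left _ _
  have hκ2 : κ ≤ η / 2 := min_le_right _ _
  have h2 : ‖d‖ ≤ 2 * ‖L t‖ := by nlinarith [norm_nonneg d]
  calc ‖d - L t‖ ≤ κ * ‖d‖ := hd
    _ ≤ κ * (2 * ‖L t‖) := mul_le_mul_of_nonneg_left h2 hκ0.le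
    _ ≤ η / 2 * (2 * ‖L t‖) := mul_le_mul_of_nonneg_right hκ2 (by positivity)
    _ = η * ‖L t‖ := by ring

end Normality

/-! ### The nonlinear regression model -/

section Model

lemma sum_enorm_sq_eq_ofReal_criterion {𝒳 : Type*} {p m : ℕ}
    (g : 𝒳 → EuclideanSpace ℝ (Fin p) → EuclideanSpace ℝ (Fin m))
    (y : ℕ → EuclideanSpace ℝ (Fin m)) (x : ℕ → 𝒳) (n : ℕ) (β : EuclideanSpace ℝ (Fin p)) :
    ∑ i ∈ Finset.range n, ‖y i - g (x i) β‖ₑ ^ 2 = ENNReal.ofReal (criterion g y x n β) := by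
  rw [criterion, ENNReal.ofReal_sum_of_nonneg fun _ _ => sq_nonneg _]
  exact Finset.sum_congr rfl fun i _ => by rw [ENNReal.ofReal_pow (norm_nonneg _), ofReal_norm]

variable {Ω 𝒳 : Type*} [MeasurableSpace Ω] [MeasurableSpace 𝒳] {P : Measure Ω}
  [IsProbabilityMeasure P] {p m : ℕ}

/-- Consistency of the nonlinear least squares estimator. -/
theorem withHighProb_nls_mem {X : ℕ → Ω → 𝒳} {Y ε : ℕ → Ω → EuclideanSpace ℝ (Fin m)}
    {Θ : Set (EuclideanSpace ℝ (Fin p))} {β₀ : EuclideanSpace ℝ (Fin p)}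
    {g : 𝒳 → EuclideanSpace ℝ (Fin p) → EuclideanSpace ℝ (Fin m)}
    (hX : ∀ i, Measurable (X i)) (hY : ∀ i, Measurable (Y i))
    (hindep : iIndepFun (fun i ω => (Y i ω, X i ω)) P)
    (hident : ∀ i, IdentDistrib (fun ω => (Y i ω, X i ω)) (fun ω => (Y 0 ω, X 0 ω)) P P)
    (hmodel : ∀ i ω, Y i ω = g (X i ω) β₀ + ε i ω)
    (hmean : P[ε 0 | MeasurableSpace.comap (X 0) inferInstance] =ᵐ[P] 0)
    (hg_meas : ∀ β ∈ Θ, Measurable fun x => g x β) (hg_cont : ∀ x, ContinuousOn (g x) Θ)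
    (hA1 : ∀ β ∈ Θ, ∫⁻ ω, ‖g (X 0 ω) β - g (X 0 ω) β₀‖ₑ ^ 2 ∂P = 0 ↔ β = β₀)
    (hβ₀ : β₀ ∈ Θ) (herr : MemLp (ε 0) 2 P)
    (hcrit : ∃ k : ℕ, ∃ K ⊆ Θ, IsCompact K ∧
      (k : ℝ≥0∞) * ∫⁻ ω, ‖ε 0 ω‖ₑ ^ 2 ∂P <
        ∫⁻ ω, ⨅ β ∈ Θ \ K, ∑ i ∈ Finset.range k, ‖Y i ω - g (X i ω) β‖ₑ ^ 2 ∂P)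
    {b : ℕ → Ω → EuclideanSpace ℝ (Fin p)}
    (hb : WithHighProb P fun n ω => b n ω ∈ Θ ∧
      IsMinOn (criterion g (fun i => Y i ω) (fun i => X i ω) n) Θ (b n ω))
    {V : Set (EuclideanSpace ℝ (Fin p))} (hV : V ∈ 𝓝 β₀) :
    WithHighProb P fun n ω => b n ω ∈ V := by
  have hε : ∀ i ω, Y i ω - g (X i ω) β₀ = ε i ω := fun i ω => by rw [hmodel]; simp
  obtain ⟨k, K, hKΘ, hK, hk⟩ := hcrit
  refine withHighProb_mem_of_isMinimizer (Z := fun i ω => (Y i ω, X i ω))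
    (q := fun z β => ‖z.1 - g z.2 β‖ₑ ^ 2) (k := k) hindep (fun i => (hY i).prodMk (hX i)) hident
    (fun β hβ => ?_) (fun z => ?_) hβ₀ (fun z => by finiteness) ?_ (fun β hβ hne => ?_) hKΘ hK ?_
    ?_ hV
  · exact ((measurable_fst.sub ((hg_meas β hβ).comp measurable_snd)).enorm).pow_const 2
  · exact (ENNReal.continuous_pow 2).comp_continuousOn (continuousOn_const.sub (hg_cont z.2)).enorm
  · simp only [hε]
    rw [lintegral_enorm_sq_eq_ofReal herr]
    exact ENNReal.ofReal_ne_top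
  · have h1 := lintegral_enorm_sq_lt_of_condExp (hX 0) herr hmean
      ((hg_meas β hβ).sub (hg_meas β₀ hβ₀)) (fun h => hne ((hA1 β hβ).1 h))
    simp only [hε]
    refine h1.trans_eq (lintegral_congr fun ω => ?_)
    rw [hmodel]
    congr 2
    simp only [Pi.sub_apply]
    abel
  · simp only [hε]
    exact hk
  · refine hb.mono (Eventually.of_forall fun n => Eventually.of_forall fun ω hω => ⟨hω.1, ?_⟩)
    intro β hβ
    simp only
    rw [sum_enorm_sq_eq_ofReal_criterion g (fun i => Y i ω) (fun i => X i ω),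
      sum_enorm_sq_eq_ofReal_criterion g (fun i => Y i ω) (fun i => X i ω)]
    exact ENNReal.ofReal_le_ofReal (hω.2 hβ)

lemma norm_le_of_apply_eq_two_mul_inner {E : Type*} [NormedAddCommGroup E] [InnerProductSpace ℝ E]
    {L : E →L[ℝ] ℝ} {w : E} (h : ∀ v, L v = 2 * inner ℝ w v) : ‖w‖ ≤ ‖L‖ := by
  rcases eq_or_ne w 0 with rfl | hw
  · simp
  have h1 := (le_abs_self _).trans (L.le_opNorm w)
  rw [h, real_inner_self_eq_norm_sq] at h1
  have := norm_pos_iff.2 hw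
  nlinarith [norm_nonneg L]

/-- The expected Hessian of the squared residual at `β₀` is `2H`: the term involving second
derivatives of `g` is a function of the regressors times a conditionally centred error. -/
lemma integral_hessian_eq {X : Ω → 𝒳} {e : Ω → EuclideanSpace ℝ (Fin m)}
    {β₀ : EuclideanSpace ℝ (Fin p)}
    {g : 𝒳 → EuclideanSpace ℝ (Fin p) → EuclideanSpace ℝ (Fin m)} (hX : Measurable X)
    (he : Integrable e P) (hmean : P[e | MeasurableSpace.comap X inferInstance] =ᵐ[P] 0)
    {U : Set (EuclideanSpace ℝ (Fin p))} (hU : IsOpen U) (hβ₀ : β₀ ∈ U)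
    (hg_meas : ∀ β ∈ U, Measurable fun x => g x β)
    (hsmooth : ∀ᵐ x ∂(P.map X), ContDiffOn ℝ 2 (g x) U)
    {H : Matrix (Fin p) (Fin p) ℝ}
    (hH : ∀ j k, Integrable (fun x => ((jacobian g x β₀)ᵀ * jacobian g x β₀) j k) (P.map X) ∧
      H j k = ∫ x, ((jacobian g x β₀)ᵀ * jacobian g x β₀) j k ∂(P.map X))
    (u v : EuclideanSpace ℝ (Fin p))
    (hint : Integrable (fun ω => fderiv ℝ (fderiv ℝ
      fun b => ‖g (X ω) β₀ + e ω - g (X ω) b‖ ^ 2) β₀ u v) P) :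
    ∫ ω, fderiv ℝ (fderiv ℝ fun b => ‖g (X ω) β₀ + e ω - g (X ω) b‖ ^ 2) β₀ u v ∂P =
      2 * inner ℝ (Matrix.toEuclideanCLM (𝕜 := ℝ) H u) v := by
  have hgm : ∀ β ∈ U, AEStronglyMeasurable (fun x => g x β) (P.map X) := fun β hβ =>
    (hg_meas β hβ).aestronglyMeasurable
  have hd1 : ∀ᵐ x ∂(P.map X), ∀ β ∈ U, DifferentiableAt ℝ (g x) β := by
    filter_upwards [hsmooth] with x hx β hβ
    exact (hx.contDiffAt (hU.mem_nhds hβ)).differentiableAt (by norm_num)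
  have hd2 : ∀ᵐ x ∂(P.map X), DifferentiableAt ℝ (fderiv ℝ (g x)) β₀ := by
    filter_upwards [hsmooth] with x hx
    exact ((hx.contDiffAt (hU.mem_nhds hβ₀)).fderiv_right (m := 1)
      (by norm_num)).differentiableAt (by norm_num)
  have hDm : ∀ β ∈ U, AEStronglyMeasurable (fun x => fderiv ℝ (g x) β) (P.map X) :=
    fun β hβ => aestronglyMeasurable_fderiv (hU.mem_nhds hβ) hgm (hd1.mono fun x hx => hx β hβ)
  have hD2m : AEStronglyMeasurable (fun x => fderiv ℝ (fderiv ℝ (g x)) β₀ u v) (P.map X) :=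
    ((aestronglyMeasurable_fderiv (hU.mem_nhds hβ₀) hDm hd2).apply_continuousLinearMap
      u).apply_continuousLinearMap v
  have hgram : ∀ x, inner ℝ (fderiv ℝ (g x) β₀ u) (fderiv ℝ (g x) β₀ v) =
      ∑ k, ∑ j, ((jacobian g x β₀)ᵀ * jacobian g x β₀) k j * (u j * v k) := fun x => by
    simp only [PiLp.inner_apply, RCLike.inner_apply, conj_trivial, fderiv_apply_eq_jacobian,
      Matrix.mul_apply, Matrix.transpose_apply, Finset.sum_mul]
    rw [Finset.sum_comm]
    refine Finset.sum_congr rfl fun k _ => ?_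
    rw [Finset.sum_comm]
    refine Finset.sum_congr rfl fun j _ => ?_
    rw [Finset.mul_sum]
    exact Finset.sum_congr rfl fun a _ => by ring
  have hgramX : ∀ j k, Integrable
      (fun ω => ((jacobian g (X ω) β₀)ᵀ * jacobian g (X ω) β₀) j k) P := fun j k =>
    (hH j k).1.comp_measurable hX
  have hI1 : Integrable (fun ω => inner ℝ (fderiv ℝ (g (X ω)) β₀ u) (fderiv ℝ (g (X ω)) β₀ v))
      P := by
    simp only [hgram]
    exact integrable_finsetSum _ fun k _ => integrable_finsetSum _ fun j _ =>
      (hgramX k j).mul_const _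
  have hE1 : ∫ ω, inner ℝ (fderiv ℝ (g (X ω)) β₀ u) (fderiv ℝ (g (X ω)) β₀ v) ∂P =
      inner ℝ (Matrix.toEuclideanCLM (𝕜 := ℝ) H u) v := by
    simp only [hgram]
    rw [integral_finsetSum _ fun k _ => integrable_finsetSum _ fun j _ =>
      (hgramX k j).mul_const _]
    simp only [PiLp.inner_apply, RCLike.inner_apply, conj_trivial, Matrix.ofLp_toEuclideanCLM,
      Matrix.mulVec, dotProduct, Finset.mul_sum]
    refine Finset.sum_congr rfl fun k _ => ?_
    rw [integral_finsetSum _ fun j _ => (hgramX k j).mul_const _]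
    refine Finset.sum_congr rfl fun j _ => ?_
    rw [integral_mul_const, (hH k j).2, integral_map hX.aemeasurable (hH k j).1.1]
    ring
  have hform : ∀ᵐ ω ∂P,
      fderiv ℝ (fderiv ℝ fun b => ‖g (X ω) β₀ + e ω - g (X ω) b‖ ^ 2) β₀ u v =
        2 * inner ℝ (fderiv ℝ (g (X ω)) β₀ u) (fderiv ℝ (g (X ω)) β₀ v) -
          2 * inner ℝ (e ω) (fderiv ℝ (fderiv ℝ (g (X ω))) β₀ u v) := by
    filter_upwards [ae_of_ae_map hX.aemeasurable hsmooth] with ω hω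
    rw [fderiv_fderiv_sq_norm_sub_apply hU hβ₀ hω, add_sub_cancel_left]
  have hI2 : Integrable (fun ω => inner ℝ (e ω) (fderiv ℝ (fderiv ℝ (g (X ω))) β₀ u v)) P := by
    refine ((hI1.sub (hint.div_const 2))).congr ?_
    filter_upwards [hform] with ω hω
    simp only [Pi.sub_apply, hω]
    ring
  have hE2 := integral_inner_eq_zero_of_condExp hX he hmean hD2m hI2
  rw [integral_congr_ae hform, integral_sub (hI1.const_mul 2) (hI2.const_mul 2),
    integral_const_mul, integral_const_mul, hE1, hE2]
  ring

/-- Linearization of the normal equations of nonlinear least squares: `H (b_n - β₀)` equals the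
average of the scores `G_i'ε_i` up to an error negligible relative to `b_n - β₀`. -/
theorem withHighProb_nls_linearization {X : ℕ → Ω → 𝒳} {Y ε : ℕ → Ω → EuclideanSpace ℝ (Fin m)}
    {Θ U : Set (EuclideanSpace ℝ (Fin p))} {β₀ : EuclideanSpace ℝ (Fin p)}
    {g : 𝒳 → EuclideanSpace ℝ (Fin p) → EuclideanSpace ℝ (Fin m)}
    (hX : ∀ i, Measurable (X i)) (hY : ∀ i, Measurable (Y i))
    (hindep : iIndepFun (fun i ω => (Y i ω, X i ω)) P)
    (hident : ∀ i, IdentDistrib (fun ω => (Y i ω, X i ω)) (fun ω => (Y 0 ω, X 0 ω)) P P)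
    (hmodel : ∀ i ω, Y i ω = g (X i ω) β₀ + ε i ω)
    (hmean : P[ε 0 | MeasurableSpace.comap (X 0) inferInstance] =ᵐ[P] 0)
    (herr : Integrable (ε 0) P)
    (hU : IsOpen U) (hUΘ : U ⊆ Θ) (hβ₀ : β₀ ∈ U)
    (hg_meas : ∀ β ∈ U, Measurable fun x => g x β)
    (hsmooth : ∀ᵐ x ∂(P.map (X 0)), ContDiffOn ℝ 2 (g x) U)
    (hhess : ∃ M : Ω → ℝ, Integrable M P ∧ ∀ᵐ ω ∂P, ∀ β ∈ U,
      ‖fderiv ℝ (fderiv ℝ fun b => ‖Y 0 ω - g (X 0 ω) b‖ ^ 2) β‖ ≤ M ω)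
    {H : Matrix (Fin p) (Fin p) ℝ}
    (hH : ∀ j k,
      Integrable (fun x => ((jacobian g x β₀)ᵀ * jacobian g x β₀) j k) (P.map (X 0)) ∧
      H j k = ∫ x, ((jacobian g x β₀)ᵀ * jacobian g x β₀) j k ∂(P.map (X 0)))
    {b : ℕ → Ω → EuclideanSpace ℝ (Fin p)}
    (hb : WithHighProb P fun n ω => b n ω ∈ Θ ∧
      IsMinOn (criterion g (fun i => Y i ω) (fun i => X i ω) n) Θ (b n ω))
    (hcons : ∀ V ∈ 𝓝 β₀, WithHighProb P fun n ω => b n ω ∈ V) {η : ℝ} (hη : 0 < η) :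
    WithHighProb P fun n ω =>
      ‖Matrix.toEuclideanCLM (𝕜 := ℝ) H (b n ω - β₀) - (n : ℝ)⁻¹ • ∑ i ∈ Finset.range n,
        (WithLp.toLp 2 ((jacobian g (X i ω) β₀)ᵀ *ᵥ (fun k => ε i ω k)) :
          EuclideanSpace ℝ (Fin p))‖ ≤ η * ‖b n ω - β₀‖ := by
  obtain ⟨M, hM, hbound⟩ := hhess
  let Z : ℕ → Ω → EuclideanSpace ℝ (Fin m) × 𝒳 := fun i ω => (Y i ω, X i ω)
  have hZ : ∀ i, Measurable (Z i) := fun i => (hY i).prodMk (hX i)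
  let q : EuclideanSpace ℝ (Fin m) × 𝒳 → EuclideanSpace ℝ (Fin p) → ℝ :=
    fun z β => ‖z.1 - g z.2 β‖ ^ 2
  have hUn : U ∈ 𝓝 β₀ := hU.mem_nhds hβ₀
  have hsmoothZ : ∀ᵐ z ∂(P.map (Z 0)), ContDiffOn ℝ 2 (g z.2) U := by
    have : P.map (X 0) = (P.map (Z 0)).map Prod.snd := by
      rw [Measure.map_map measurable_snd (hZ 0)]
      rfl
    rw [this] at hsmooth
    exact ae_of_ae_map measurable_snd.aemeasurable hsmooth
  have hsmoothΩ : ∀ᵐ ω ∂P, ∀ i, ContDiffOn ℝ 2 (g (X i ω)) U := by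
    rw [ae_all_iff]
    intro i
    have : ∀ᵐ z ∂(P.map (Z i)), ContDiffOn ℝ 2 (g z.2) U := by
      rw [(hident i).map_eq]
      exact hsmoothZ
    exact ae_of_ae_map (hZ i).aemeasurable this
  have hqm : ∀ β ∈ U, AEStronglyMeasurable (fun z => q z β) (P.map (Z 0)) := fun β hβ =>
    ((measurable_fst.sub ((hg_meas β hβ).comp measurable_snd)).norm.pow_const
      2).aestronglyMeasurable
  have hd1 : ∀ᵐ z ∂(P.map (Z 0)), ∀ β ∈ U, DifferentiableAt ℝ (q z) β := by
    filter_upwards [hsmoothZ] with z hz β hβ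
    exact ((contDiffOn_sq_norm_sub hz).contDiffAt (hU.mem_nhds hβ)).differentiableAt (by norm_num)
  have hd2 : ∀ᵐ z ∂(P.map (Z 0)), ∀ β ∈ U, DifferentiableAt ℝ (fderiv ℝ (q z)) β := by
    filter_upwards [hsmoothZ] with z hz β hβ
    exact (((contDiffOn_sq_norm_sub hz).contDiffAt (hU.mem_nhds hβ)).fderiv_right (m := 1)
      (by norm_num)).differentiableAt (by norm_num)
  have hfm : ∀ β ∈ U, AEStronglyMeasurable (fun z => fderiv ℝ (q z) β) (P.map (Z 0)) :=
    fun β hβ => aestronglyMeasurable_fderiv (hU.mem_nhds hβ) hqm (hd1.mono fun z hz => hz β hβ)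
  let A : EuclideanSpace ℝ (Fin p) →L[ℝ] EuclideanSpace ℝ (Fin p) →L[ℝ] ℝ :=
    (2 : ℝ) • (innerSL ℝ).comp (Matrix.toEuclideanCLM (𝕜 := ℝ) H)
  have hAapp : ∀ u v, A u v = 2 * inner ℝ (Matrix.toEuclideanCLM (𝕜 := ℝ) H u) v := fun u v => by
    simp [A]
  have hHess := integrable_fderiv_of_bound (hZ 0) hUn hfm hd2 hM hbound
  have hA : ∀ u, ∫ z, fderiv ℝ (fderiv ℝ (q z)) β₀ u ∂(P.map (Z 0)) = A u := fun u => by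
    have hi1 : Integrable (fun z => fderiv ℝ (fderiv ℝ (q z)) β₀ u) (P.map (Z 0)) :=
      hHess.apply_continuousLinearMap u
    ext v
    have hi2 : Integrable (fun z => fderiv ℝ (fderiv ℝ (q z)) β₀ u v) (P.map (Z 0)) :=
      hi1.apply_continuousLinearMap v
    rw [ContinuousLinearMap.integral_apply hi1, integral_map (hZ 0).aemeasurable hi2.1, hAapp]
    have hi3 := hi2.comp_measurable (hZ 0)
    have := integral_hessian_eq (hX 0) herr hmean hU hβ₀ hg_meas hsmooth hH u v
      (by simp only [← hmodel]; exact hi3)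
    simp only [← hmodel] at this
    exact this
  have hroot : WithHighProb P fun n ω =>
      ∑ i ∈ Finset.range n, fderiv ℝ (q (Z i ω)) (b n ω) = 0 := by
    refine (hb.and (hcons U hUn)).mono (Eventually.of_forall fun n => ?_)
    filter_upwards [hsmoothΩ] with ω hω
    rintro ⟨⟨-, hmin⟩, hbU⟩
    have hloc : IsLocalMin (fun β => ∑ i ∈ Finset.range n, q (Z i ω) β) (b n ω) := by
      filter_upwards [hU.mem_nhds hbU] with β hβ using hmin (hUΘ hβ)
    have := hloc.fderiv_eq_zero
    rwa [fderiv_fun_sum fun i _ => ((contDiffOn_sq_norm_sub (hω i)).contDiffAt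
      (hU.mem_nhds hbU)).differentiableAt (by norm_num)] at this
  refine (withHighProb_linearization (fun i j hij => hindep.indepFun hij) hZ hident hUn hfm hd2 hM
    hbound hA hroot hcons hη).mono (Eventually.of_forall fun n => ?_)
  filter_upwards [hsmoothΩ] with ω hω hlin
  refine (norm_le_of_apply_eq_two_mul_inner fun v => ?_).trans hlin
  have hscore : ∀ i, fderiv ℝ (q (Y i ω, X i ω)) β₀ v = -2 * inner ℝ
      (WithLp.toLp 2 ((jacobian g (X i ω) β₀)ᵀ *ᵥ (fun k => ε i ω k)) :
          EuclideanSpace ℝ (Fin p)) v := fun i => by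
    have h1 : fderiv ℝ (q (Z i ω)) β₀ v =
        -2 * inner ℝ (Y i ω - g (X i ω) β₀) (fderiv ℝ (g (X i ω)) β₀ v) :=
      fderiv_sq_norm_sub_apply
        (((hω i).contDiffAt (hU.mem_nhds hβ₀)).differentiableAt (by norm_num)) v
    rw [h1, hmodel, add_sub_cancel_left, inner_fderiv_eq_dotProduct]
  simp only [add_apply, smul_apply, sum_apply, hscore, hAapp, smul_eq_mul]
  rw [inner_sub_left, real_inner_smul_left, sum_inner, ← Finset.mul_sum]
  ring

end Model

/-! ### The score and its covariance -/

section Score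

variable {Ω 𝒳 : Type*} [MeasurableSpace Ω] [MeasurableSpace 𝒳] {P : Measure Ω} {p m : ℕ}

lemma aestronglyMeasurable_jacobian {μ : Measure 𝒳}
    {g : 𝒳 → EuclideanSpace ℝ (Fin p) → EuclideanSpace ℝ (Fin m)}
    {U : Set (EuclideanSpace ℝ (Fin p))} {β : EuclideanSpace ℝ (Fin p)} (hU : U ∈ 𝓝 β)
    (hg : ∀ β' ∈ U, Measurable fun x => g x β') (hd : ∀ᵐ x ∂μ, DifferentiableAt ℝ (g x) β)
    (a : Fin m) (j : Fin p) : AEStronglyMeasurable (fun x => jacobian g x β a j) μ := by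
  have h1 := aestronglyMeasurable_fderiv hU (fun β' hβ' => (hg β' hβ').aestronglyMeasurable) hd
  have h2 := (EuclideanSpace.proj a : EuclideanSpace ℝ (Fin m) →L[ℝ] ℝ).continuous
  exact h2.comp_aestronglyMeasurable (h1.apply_continuousLinearMap (EuclideanSpace.single j 1))

/-- The score `A(x)'e`, as a function of the error `e` and the regressor `x`. -/
def score (A : 𝒳 → Matrix (Fin m) (Fin p) ℝ) (z : EuclideanSpace ℝ (Fin m) × 𝒳) :
    EuclideanSpace ℝ (Fin p) :=
  WithLp.toLp 2 ((A z.2)ᵀ *ᵥ fun a => z.1 a)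

lemma aemeasurable_score {A : 𝒳 → Matrix (Fin m) (Fin p) ℝ}
    {Z : Ω → EuclideanSpace ℝ (Fin m) × 𝒳} (hZ : Measurable Z)
    (hA : ∀ a j, AEStronglyMeasurable (fun x => A x a j) (P.map fun ω => (Z ω).2)) :
    AEMeasurable (score A) (P.map Z) := by
  have hmap : P.map (fun ω => (Z ω).2) = (P.map Z).map Prod.snd := by
    rw [Measure.map_map measurable_snd hZ]
    rfl
  rw [hmap] at hA
  refine (WithLp.measurable_toLp 2 _).comp_aemeasurable (aemeasurable_pi_lambda _ fun j => ?_)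
  simp only [Matrix.mulVec, dotProduct, Matrix.transpose_apply]
  refine Finset.aemeasurable_fun_sum _ fun a _ => ?_
  refine ((hA a j).aemeasurable.comp_measurable measurable_snd).mul (Measurable.aemeasurable ?_)
  exact (EuclideanSpace.proj a : EuclideanSpace ℝ (Fin m) →L[ℝ] ℝ).measurable.comp measurable_fst

lemma integral_score_eq_zero [IsProbabilityMeasure P] {X : Ω → 𝒳} (hX : Measurable X)
    {e : Ω → EuclideanSpace ℝ (Fin m)} (he : Integrable e P)
    (hmean : P[e | MeasurableSpace.comap X inferInstance] =ᵐ[P] 0)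
    {A : 𝒳 → Matrix (Fin m) (Fin p) ℝ}
    (hA : ∀ a j, AEStronglyMeasurable (fun x => A x a j) (P.map X))
    (hs : Integrable (fun ω => score A (e ω, X ω)) P) :
    ∫ ω, score A (e ω, X ω) ∂P = 0 := by
  ext j
  have hsj : ∀ ω, score A (e ω, X ω) j =
      inner ℝ (e ω) (WithLp.toLp 2 (fun a => A (X ω) a j) : EuclideanSpace ℝ (Fin m)) := fun ω => by
    simp [score, Matrix.mulVec, dotProduct, PiLp.inner_apply]
  have hproj := (EuclideanSpace.proj j : EuclideanSpace ℝ (Fin p) →L[ℝ] ℝ).integral_comp_comm hs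
  have hint := (EuclideanSpace.proj j : EuclideanSpace ℝ (Fin p) →L[ℝ] ℝ).integrable_comp hs
  simp only [PiLp.proj_apply, hsj] at hproj hint
  rw [PiLp.zero_apply, ← hproj]
  refine integral_inner_eq_zero_of_condExp (h := fun x => WithLp.toLp 2 fun a => A x a j)
    hX he hmean ?_ hint
  exact ((WithLp.measurable_toLp 2 _).comp_aemeasurable
    (aemeasurable_pi_lambda _ fun a => (hA a j).aemeasurable)).aestronglyMeasurable

/-- Law of large numbers for the sandwich `G_i' Var(ε_i | X_i) G_i`. Each term is the conditional
second moment of the score given `X_i`, hence one fixed function of the i.i.d. pairs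
`(ε_i, X_i)`, and its mean is the second moment of the score. -/
theorem isPlimAverage_sandwich [IsProbabilityMeasure P] {X : ℕ → Ω → 𝒳}
    {ε : ℕ → Ω → EuclideanSpace ℝ (Fin m)}
    (hX : ∀ i, Measurable (X i)) (hε : ∀ i, Measurable (ε i))
    (hind : Pairwise fun i j => IndepFun (fun ω => (ε i ω, X i ω)) (fun ω => (ε j ω, X j ω)) P)
    (hid : ∀ i, IdentDistrib (fun ω => (ε i ω, X i ω)) (fun ω => (ε 0 ω, X 0 ω)) P P)
    (hmean : ∀ i, P[ε i | MeasurableSpace.comap (X i) inferInstance] =ᵐ[P] 0)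
    (herr : MemLp (ε 0) 2 P) {A : 𝒳 → Matrix (Fin m) (Fin p) ℝ}
    (hA : ∀ a j, AEStronglyMeasurable (fun x => A x a j) (P.map (X 0)))
    (hs : ∀ j, MemLp (fun ω => score A (ε 0 ω, X 0 ω) j) 2 P) :
    IsPlimAverage P (fun i ω => (A (X i ω))ᵀ * condCov P (ε i) (X i) ω * A (X i ω))
      (Matrix.of fun j k =>
        ∫ ω, score A (ε 0 ω, X 0 ω) j * score A (ε 0 ω, X 0 ω) k ∂P) := by
  intro j k
  let Z : ℕ → Ω → EuclideanSpace ℝ (Fin m) × 𝒳 := fun i ω => (ε i ω, X i ω)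
  have hZ : ∀ i, Measurable (Z i) := fun i => (hε i).prodMk (hX i)
  have hscm : AEMeasurable (score A) (P.map (Z 0)) := aemeasurable_score (hZ 0) hA
  have hcoord : ∀ l, AEMeasurable (fun z => score A z l) (P.map (Z 0)) := fun l =>
    (EuclideanSpace.proj l : EuclideanSpace ℝ (Fin p) →L[ℝ] ℝ).measurable.comp_aemeasurable hscm
  let f : EuclideanSpace ℝ (Fin m) × 𝒳 → ℝ := fun z => score A z j * score A z k
  have hfm : AEStronglyMeasurable f (P.map (Z 0)) :=
    ((hcoord j).mul (hcoord k)).aestronglyMeasurable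
  have hf : Integrable f (P.map (Z 0)) := by
    rw [integrable_map_measure hfm (hZ 0).aemeasurable]
    exact (hs j).integrable_mul (hs k)
  let φ : EuclideanSpace ℝ (Fin m) × 𝒳 → ℝ :=
    (P.map (Z 0))[f | MeasurableSpace.comap Prod.snd inferInstance]
  have hlln := tendstoInMeasure_average (f := φ) hind hid integrable_condExp
  have hφ : ∫ z, φ z ∂(P.map (Z 0)) =
      ∫ ω, score A (ε 0 ω, X 0 ω) j * score A (ε 0 ω, X 0 ω) k ∂P := by
    have : IsProbabilityMeasure (P.map (Z 0)) :=
      Measure.isProbabilityMeasure_map (hZ 0).aemeasurable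
    rw [integral_condExp measurable_snd.comap_le, integral_map (hZ 0).aemeasurable hfm]
  have hterm : ∀ i, (fun ω => φ (Z i ω)) =ᵐ[P]
      fun ω => ((A (X i ω))ᵀ * condCov P (ε i) (X i) ω * A (X i ω)) j k := fun i => by
    have hmap : P.map (Z i) = P.map (Z 0) := (hid i).map_eq
    have h1 := condExp_comp_ae_eq (hZ i) (π := Prod.snd) measurable_snd (hmap ▸ hf)
    rw [hmap] at h1
    have hmapX : P.map (X i) = P.map (X 0) := ((hid i).comp measurable_snd).map_eq
    have hsi : ∀ l, MemLp (fun ω => score A (ε i ω, X i ω) l) 2 P := fun l =>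
      (((hid i).comp_of_aemeasurable (u := fun z => score A z l)
        (by rw [(hid i).map_eq]; exact hcoord l)).memLp_iff).2 (hs l)
    have h2 := transpose_mul_condCov_mul_ae_eq (hX i)
      (((hid i).comp measurable_fst).memLp_iff.2 herr) (hmean i) (hmapX ▸ hA) hsi j k
    exact h1.trans h2.symm
  rw [show (fun _ : Ω => ∫ z, φ z ∂(P.map fun ω => (ε 0 ω, X 0 ω))) = fun _ =>
    ∫ ω, score A (ε 0 ω, X 0 ω) j * score A (ε 0 ω, X 0 ω) k ∂P from funext fun _ => hφ] at hlln
  refine hlln.congr_left fun n => ?_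
  filter_upwards [ae_all_iff.2 hterm] with ω hω
  rw [smul_eq_mul]
  exact congrArg _ (Finset.sum_congr rfl fun i _ => hω i)

/-- Under homoscedasticity the second moment of the score is the mean of `G'SG`. -/
lemma isExpectation_sandwich [IsProbabilityMeasure P] {X : Ω → 𝒳} (hX : Measurable X)
    {e : Ω → EuclideanSpace ℝ (Fin m)} (he : MemLp e 2 P)
    (hmean : P[e | MeasurableSpace.comap X inferInstance] =ᵐ[P] 0)
    {A : 𝒳 → Matrix (Fin m) (Fin p) ℝ}
    (hA : ∀ a j, AEStronglyMeasurable (fun x => A x a j) (P.map X))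
    (hs : ∀ j, MemLp (fun ω => score A (e ω, X ω) j) 2 P)
    {S : Matrix (Fin m) (Fin m) ℝ} (hS : ∀ᵐ ω ∂P, condCov P e X ω = S) :
    IsExpectation P (fun ω => (A (X ω))ᵀ * S * A (X ω))
      (Matrix.of fun j k => ∫ ω, score A (e ω, X ω) j * score A (e ω, X ω) k ∂P) := by
  intro j k
  have h1 : P[fun ω => score A (e ω, X ω) j * score A (e ω, X ω) k |
      MeasurableSpace.comap X inferInstance] =ᵐ[P] fun ω => ((A (X ω))ᵀ * S * A (X ω)) j k := by
    refine (transpose_mul_condCov_mul_ae_eq hX he hmean hA hs j k).symm.trans ?_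
    filter_upwards [hS] with ω hω
    rw [hω]
  refine ⟨integrable_condExp.congr h1, ?_⟩
  rw [← integral_congr_ae h1, integral_condExp hX.comap_le]
  rfl

end Score

end NLS

theorem mainTheorem1 {Ω 𝒳 : Type*} [MeasurableSpace Ω] [MeasurableSpace 𝒳]
    (P : Measure Ω) [IsProbabilityMeasure P] {p m : ℕ}
    -- the model `Y_i = g(X_i, β₀) + ε_i` with i.i.d. data
    (X : ℕ → Ω → 𝒳) (Y ε : ℕ → Ω → EuclideanSpace ℝ (Fin m))
    (Θ : Set (EuclideanSpace ℝ (Fin p))) (β₀ : EuclideanSpace ℝ (Fin p))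
    (g : 𝒳 → EuclideanSpace ℝ (Fin p) → EuclideanSpace ℝ (Fin m))
    (hX : ∀ i, Measurable (X i)) (hY : ∀ i, Measurable (Y i))
    (hindep : iIndepFun (fun i ω => (Y i ω, X i ω)) P)
    (hident : ∀ i, IdentDistrib (fun ω => (Y i ω, X i ω)) (fun ω => (Y 0 ω, X 0 ω)) P P)
    (hmodel : ∀ i ω, Y i ω = g (X i ω) β₀ + ε i ω)
    (hmean : ∀ i, P[ε i | MeasurableSpace.comap (X i) inferInstance] =ᵐ[P] 0)
    (hg_meas : ∀ β ∈ Θ, Measurable fun x => g x β)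
    (hg_cont : ∀ x, ContinuousOn (g x) Θ)
    -- (A1) identifiability
    (hA1 : ∀ β ∈ Θ, ∫⁻ ω, ‖g (X 0 ω) β - g (X 0 ω) β₀‖ₑ ^ 2 ∂P = 0 ↔ β = β₀)
    -- (A2) interior point
    (hA2 : β₀ ∈ interior Θ)
    -- (A3) smoothness near `β₀`
    (U : Set (EuclideanSpace ℝ (Fin p))) (hU : IsOpen U) (hUΘ : U ⊆ Θ) (hβ₀U : β₀ ∈ U)
    (hA3 : ∀ᵐ x ∂(P.map (X 0)), ContDiffOn ℝ 2 (g x) U)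
    -- (A4) second moments of the errors
    (hA4_err : MemLp (ε 0) 2 P)
    -- (A4) multivariate CLT: second moments of the score
    (hA4_clt : ∀ j, MemLp
      (fun ω => ((NLS.jacobian g (X 0 ω) β₀)ᵀ *ᵥ (fun k => ε 0 ω k)) j) 2 P)
    -- (A4) LLN for the Hessian of the criterion, uniformly near `β₀`
    (hA4_hess : ∃ M : Ω → ℝ, Integrable M P ∧ ∀ᵐ ω ∂P, ∀ β ∈ U,
      ‖fderiv ℝ (fderiv ℝ fun b => ‖Y 0 ω - g (X 0 ω) b‖ ^ 2) β‖ ≤ M ω)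
    -- (A4) LLN for the criterion away from `β₀`: automatic if `Θ` is compact (take `K = Θ`)
    (hA4_crit : ∃ k : ℕ, ∃ K ⊆ Θ, IsCompact K ∧
      (k : ℝ≥0∞) * ∫⁻ ω, ‖ε 0 ω‖ₑ ^ 2 ∂P <
        ∫⁻ ω, ⨅ β ∈ Θ \ K, ∑ i ∈ Finset.range k, ‖Y i ω - g (X i ω) β‖ₑ ^ 2 ∂P)
    -- (A5) nonsingularity
    (H : Matrix (Fin p) (Fin p) ℝ)
    (hA5 : NLS.IsPlimAverage P
      (fun i ω => (NLS.jacobian g (X i ω) β₀)ᵀ * NLS.jacobian g (X i ω) β₀) H)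
    (hH : H.PosDef)
    -- the nonlinear least squares estimator
    (b : ℕ → Ω → EuclideanSpace ℝ (Fin p)) (hb_meas : ∀ n, AEMeasurable (b n) P)
    (hb : Tendsto (fun n => P {ω | ¬ (b n ω ∈ Θ ∧
      IsMinOn (NLS.criterion g (fun i => Y i ω) (fun i => X i ω) n) Θ (b n ω))})
      atTop (𝓝 0)) :
    ∃ J : Matrix (Fin p) (Fin p) ℝ,
      NLS.IsPlimAverage P
        (fun i ω => (NLS.jacobian g (X i ω) β₀)ᵀ * NLS.condCov P (ε i) (X i) ω *
          NLS.jacobian g (X i ω) β₀) J ∧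
      NLS.AsymptoticallyNormal P b β₀ (H⁻¹ * J * H⁻¹) ∧
      -- homoscedastic errors
      ∀ S : Matrix (Fin m) (Fin m) ℝ,
        (∀ i, ∀ᵐ ω ∂P, NLS.condCov P (ε i) (X i) ω = S) →
        (∀ i, NLS.IsExpectation P
          (fun ω => (NLS.jacobian g (X i ω) β₀)ᵀ * NLS.jacobian g (X i ω) β₀) H) ∧
        (∀ i, NLS.IsExpectation P
          (fun ω => (NLS.jacobian g (X i ω) β₀)ᵀ * S * NLS.jacobian g (X i ω) β₀) J) ∧
        ∀ σ : ℝ, S = σ ^ 2 • (1 : Matrix (Fin m) (Fin m) ℝ) →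
          NLS.AsymptoticallyNormal P b β₀ (σ ^ 2 • H⁻¹) := by
  have hβ₀Θ : β₀ ∈ Θ := interior_subset hA2
  have hUn : U ∈ 𝓝 β₀ := hU.mem_nhds hβ₀U
  have hgU : ∀ β ∈ U, Measurable fun x => g x β := fun β hβ => hg_meas β (hUΘ hβ)
  have hε : ∀ i ω, ε i ω = Y i ω - g (X i ω) β₀ := fun i ω => by rw [hmodel]; simp
  -- the pairs `(ε_i, X_i)` are i.i.d. as images of the data under one measurable map
  let T : EuclideanSpace ℝ (Fin m) × 𝒳 → EuclideanSpace ℝ (Fin m) × 𝒳 :=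
    fun z => (z.1 - g z.2 β₀, z.2)
  have hT : Measurable T :=
    (measurable_fst.sub ((hg_meas β₀ hβ₀Θ).comp measurable_snd)).prodMk measurable_snd
  let Z : ℕ → Ω → EuclideanSpace ℝ (Fin m) × 𝒳 := fun i ω => (ε i ω, X i ω)
  have hZT : ∀ i, Z i = T ∘ fun ω => (Y i ω, X i ω) := fun i => by
    funext ω
    simp only [Z, T, hε, Function.comp]
  have hεm : ∀ i, Measurable (ε i) := fun i => by
    rw [funext (hε i)]
    exact (hY i).sub ((hg_meas β₀ hβ₀Θ).comp (hX i))
  have hZ : ∀ i, Measurable (Z i) := fun i => (hεm i).prodMk (hX i)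
  have hZind : iIndepFun Z P := by
    rw [funext hZT]
    exact hindep.comp (fun _ => T) fun _ => hT
  have hZid : ∀ i, IdentDistrib (Z i) (Z 0) P P := fun i => by
    rw [hZT i, hZT 0]
    exact (hident i).comp hT
  have hXid : ∀ i, IdentDistrib (X i) (X 0) P P := fun i => (hident i).comp measurable_snd
  have hXind : Pairwise fun i j => IndepFun (X i) (X j) P := fun i j hij =>
    (hindep.indepFun hij).comp measurable_snd measurable_snd
  have herr : ∀ i, MemLp (ε i) 2 P := fun i =>
    ((hZid i).comp measurable_fst).memLp_iff.2 hA4_err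
  let A : 𝒳 → Matrix (Fin m) (Fin p) ℝ := fun x => NLS.jacobian g x β₀
  have hA : ∀ a j, AEStronglyMeasurable (fun x => A x a j) (P.map (X 0)) :=
    NLS.aestronglyMeasurable_jacobian hUn hgU (hA3.mono fun x hx =>
      (hx.contDiffAt hUn).differentiableAt (by norm_num))
  have hAi : ∀ i a j, AEStronglyMeasurable (fun x => A x a j) (P.map (X i)) := fun i => by
    rw [(hXid i).map_eq]
    exact hA
  have hgram := NLS.integrable_gram_of_isPlimAverage hXind hXid hA hA5
  -- the scores `s_i = G_i'ε_i`
  have hscm : AEMeasurable (NLS.score A) (P.map (Z 0)) := NLS.aemeasurable_score (hZ 0) hA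
  have hscmi : ∀ i, AEMeasurable (NLS.score A) (P.map (Z i)) := fun i => by
    rw [(hZid i).map_eq]
    exact hscm
  have hsid : ∀ i, IdentDistrib (fun ω => NLS.score A (Z i ω)) (fun ω => NLS.score A (Z 0 ω)) P P :=
    fun i => (hZid i).comp_of_aemeasurable (hscmi i)
  have hsind : iIndepFun (fun i ω => NLS.score A (Z i ω)) P :=
    hZind.comp₀ (fun _ => NLS.score A) (fun i => (hZ i).aemeasurable) hscmi
  have hs0 : MemLp (fun ω => NLS.score A (Z 0 ω)) 2 P := MemLp.of_eval_piLp hA4_clt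
  have hs : ∀ i j, MemLp (fun ω => NLS.score A (Z i ω) j) 2 P := fun i j =>
    (EuclideanSpace.proj j : EuclideanSpace ℝ (Fin p) →L[ℝ] ℝ).comp_memLp'
      ((hsid i).memLp_iff.2 hs0)
  have hmean0 := NLS.integral_score_eq_zero (hX 0) ((herr 0).integrable (by norm_num)) (hmean 0) hA
    (hs0.integrable (by norm_num))
  have hcons : ∀ V ∈ 𝓝 β₀, NLS.WithHighProb P fun n ω => b n ω ∈ V := fun V hV =>
    NLS.withHighProb_nls_mem hX hY hindep hident hmodel (hmean 0) hg_meas hg_cont hA1 hβ₀Θ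
      hA4_err hA4_crit hb hV
  obtain ⟨J, hJ⟩ : ∃ J : Matrix (Fin p) (Fin p) ℝ, J = Matrix.of fun j k =>
      ∫ ω, NLS.score A (Z 0 ω) j * NLS.score A (Z 0 ω) k ∂P := ⟨_, rfl⟩
  have hnormal : NLS.AsymptoticallyNormal P b β₀ (H⁻¹ * J * H⁻¹) := by
    rw [hJ]
    exact NLS.asymptoticallyNormal_of_linearization hs0 hmean0 hsind hsid hH hb_meas fun η hη =>
      NLS.withHighProb_nls_linearization hX hY hindep hident hmodel (hmean 0)
        ((herr 0).integrable (by norm_num)) hU hUΘ hβ₀U hgU hA3 hA4_hess hgram hb hcons hη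
  have hplim : NLS.IsPlimAverage P (fun i ω => (A (X i ω))ᵀ * NLS.condCov P (ε i) (X i) ω *
      A (X i ω)) J := by
    rw [hJ]
    exact NLS.isPlimAverage_sandwich hX hεm (fun i j hij => hZind.indepFun hij) hZid hmean
      hA4_err hA hA4_clt
  refine ⟨J, hplim, hnormal, fun S hS => ?_⟩
  have hHexp : ∀ i, NLS.IsExpectation P (fun ω => (A (X i ω))ᵀ * A (X i ω)) H := fun i j k => by
    obtain ⟨h1, h2⟩ := hgram j k
    rw [← (hXid i).map_eq] at h1 h2
    exact ⟨h1.comp_measurable (hX i), by rw [h2, integral_map (hX i).aemeasurable h1.1]⟩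
  have hJexp : ∀ i, NLS.IsExpectation P (fun ω => (A (X i ω))ᵀ * S * A (X i ω)) J := fun i j k => by
    obtain ⟨h1, h2⟩ := NLS.isExpectation_sandwich (hX i) (herr i) (hmean i) (hAi i) (hs i)
      (hS i) j k
    refine ⟨h1, Eq.trans ?_ h2⟩
    rw [hJ]
    have hm : Measurable fun v : EuclideanSpace ℝ (Fin p) => v j * v k := by fun_prop
    exact ((hsid i).comp hm).integral_eq.symm
  refine ⟨hHexp, hJexp, fun σ hσ => ?_⟩
  have hJH : J = σ ^ 2 • H := by
    ext j k
    rw [(hJexp 0 j k).2, Matrix.smul_apply, (hHexp 0 j k).2, smul_eq_mul, ← integral_const_mul]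
    simp [hσ]
  rw [hJH, Matrix.mul_smul, Matrix.smul_mul, Matrix.nonsing_inv_mul _
    ((Matrix.isUnit_iff_isUnit_det _).1 hH.isUnit), Matrix.one_mul] at hnormal
  exact hnormal
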